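/- Let $n\ge 2$ and let $P=P_1P_2\dots P_{2n}$ be a non-degenerate convex polygon in $\mathbb R^2$, symmetric about the origin ($P_{i+n}=-P_i$), with vertices in counterclockwise order and indices extended $2n$-periodically to $\mathbb Z$. Write $[v,w]$ for the determinant with columns $v,w$, $\Delta_iL=L_{i+1}-L_i$ and $\nabla_iL=L_i-L_{i-1}$. Let $Q$ be the dual polygon, i.e. the unique polygon with $[P_i,Q_i]=1$ and $[\Delta_iP,Q_i]=[P_{i+1},\Delta_iQ]=0$ for all $i$, and put $$\alpha_i=\frac1{[Q_i,Q_{i+1}]},\qquad \beta_i=\frac1{[P_i,P_{i+1}]}.$$ Let $m\ge1$, and let $mP$ be the $2mn$-gon obtained by traversing $P$ $m$ times. Let $L_{mP}$ be the $2mn$-dimensional space of real sequences $r=(r_i)_{i\in\mathbb Z}$ with $r_{i+2mn}=r_i$ (the curvature radii of the polygonal lines $M$ with $\Delta_iM=r_i\Delta_iP$), and let $$S_{mP}=\{r: r_{i+mn}=r_i\ \forall i\},\qquad A_{mP}=\{r: r_{i+mn}=-r_i\ \forall i\}.$$ The double evolute transform $T_{mP}:L_{mP}\to L_{mP}$ is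 $(T_{mP}r)_i=-\beta_i\nabla_i(\alpha_i\Delta_ir)$; it maps $S_{mP}$ and $A_{mP}$ into themselves. A cycloid associated with an eigenvalue $\sigma$ is a nonzero $r\in L_{mP}$ with $T_{mP}r=\sigma r$. A cusp of $r$ is a vertex whose two neighbouring non-degenerate sides ($r_i\neq0$) have radii of opposite sign; cusps are counted over one period of $2mn$ sides, consecutive degenerate sides ($r_i=0$) being collapsed into one vertex. Then $T_{mP}$ is diagonalizable over $\mathbb R$, and its $2mn$ eigenvalues, counted with multiplicity, can be ordered as $$\sigma_0=0<\sigma_1^1\le\sigma_1^2<\sigma_2^1\le\sigma_2^2<\dots<\sigma_m^1=\sigma_m^2=1<\dots<\sigma_{mn-1}^1\le\sigma_{mn-1}^2<\sigma_{mn},$$ where the eigenvalues of $T_{mP}|_{A_{mP}}$, counted with multiplicity, are exactly those of odd index $k$, and the eigenvalues of $T_{mP}|_{S_{mP}}$, counted with multiplicity, are exactly those of even index $k$ (including $\sigma_0$; the index of $\sigma_{mn}$ is $k=mn$). Moreover, every cycloid associated with an eigenvalue of index $k$ (that is, $\sigma_0$ for $k=0$, $\sigma_k^1$ or $\sigma_k^2$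 for $1\le k\le mn-1$, and $\sigma_{mn}$ for $k=mn$) has exactly $2k$ cusps; so the numbers of cusps are respectively $0,2,2,4,4,\dots,2mn-2,2mn-2,2mn$. -/

import Mathlib

/-- The determinant `[v, w]` of the matrix with columns `v` and `w`. -/
def det₂ (v w : Fin 2 → ℝ) : ℝ := Matrix.det !![v 0, w 0; v 1, w 1]

theorem det₂_apply (v w : Fin 2 → ℝ) : det₂ v w = v 0 * w 1 - w 0 * v 1 := by
  simp [det₂, Matrix.det_fin_two_of]

/-- The forward difference `Δᵢ L = Lᵢ₊₁ - Lᵢ`. -/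
def fwdDiffSeq {E : Type*} [AddCommGroup E] (L : ℤ → E) (i : ℤ) : E := L (i + 1) - L i

/-- The backward difference `∇ᵢ L = Lᵢ - Lᵢ₋₁`. -/
def bwdDiffSeq {E : Type*} [AddCommGroup E] (L : ℤ → E) (i : ℤ) : E := L i - L (i - 1)

/-- A non-degenerate convex polygon `P₁ P₂ … P₂ₙ` in the plane, symmetric about the origin, with
its vertices in counterclockwise order; the vertices are indexed by `ℤ` with period `2n`.
Convexity: every vertex other than `Pᵢ` and `Pᵢ₊₁` lies strictly to the left of the oriented line
`Pᵢ Pᵢ₊₁`. (This forces the `2n` vertices to be distinct and to be met exactly once in a turn.) -/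
structure SymmetricBall (n : ℕ) where
  vertex : ℤ → Fin 2 → ℝ
  two_le : 2 ≤ n
  symm : ∀ i, vertex (i + n) = -vertex i
  convex : ∀ i j : ℤ, ¬ j ≡ i [ZMOD 2 * n] → ¬ j ≡ i + 1 [ZMOD 2 * n] →
    0 < det₂ (fwdDiffSeq vertex i) (vertex j - vertex i)

namespace SymmetricBall

variable {n : ℕ} (P : SymmetricBall n)

/-- The vertices `Qᵢ = Δᵢ P / [Pᵢ, Pᵢ₊₁]` of the dual polygon; see `dual_spec` and
`dual_unique` for its characterization. -/
noncomputable def dual (i : ℤ) : Fin 2 → ℝ :=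
  (1 / det₂ (P.vertex i) (P.vertex (i + 1))) • fwdDiffSeq P.vertex i

/-- `αᵢ = 1 / [Qᵢ, Qᵢ₊₁]`. -/
noncomputable def α (i : ℤ) : ℝ := 1 / det₂ (P.dual i) (P.dual (i + 1))

/-- `βᵢ = 1 / [Pᵢ, Pᵢ₊₁]`. -/
noncomputable def β (i : ℤ) : ℝ := 1 / det₂ (P.vertex i) (P.vertex (i + 1))

theorem det₂_vertex_pos (i : ℤ) : 0 < det₂ (P.vertex i) (P.vertex (i + 1)) := by
  have hn := P.two_le
  have h := P.convex i (i + n)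
    (by
      intro h
      have h1 := (Int.modEq_iff_dvd.1 h.symm)
      have h2 : (2 * n : ℤ) ∣ n := by simpa using h1
      have := Int.le_of_dvd (by omega) h2
      omega)
    (by
      intro h
      have h1 := (Int.modEq_iff_dvd.1 h.symm)
      have h2 : (2 * n : ℤ) ∣ (n : ℤ) - 1 := by
        have e : (i + n - (i + 1) : ℤ) = n - 1 := by ring
        rwa [e] at h1
      have := Int.le_of_dvd (by omega) h2
      omega)
  rw [P.symm] at h
  simp only [det₂_apply, fwdDiffSeq, Pi.sub_apply, Pi.neg_apply] at h ⊢
  linarith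

theorem dual_spec (i : ℤ) :
    det₂ (P.vertex i) (P.dual i) = 1 ∧ det₂ (fwdDiffSeq P.vertex i) (P.dual i) = 0 ∧
      det₂ (P.vertex (i + 1)) (fwdDiffSeq P.dual i) = 0 := by
  have hA : ∀ j, det₂ (P.vertex j) (P.dual j) = 1 := by
    intro j
    have hj := (P.det₂_vertex_pos j).ne'
    simp only [det₂_apply] at hj
    simp only [det₂_apply, dual, fwdDiffSeq, Pi.sub_apply, Pi.smul_apply, smul_eq_mul]
    field_simp
    ring
  have hB : det₂ (fwdDiffSeq P.vertex i) (P.dual i) = 0 := by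
    simp only [det₂_apply, dual, fwdDiffSeq, Pi.sub_apply, Pi.smul_apply, smul_eq_mul]
    ring
  refine ⟨hA i, hB, ?_⟩
  have h1 := hA i
  have h2 := hA (i + 1)
  simp only [det₂_apply, fwdDiffSeq, Pi.sub_apply] at h1 h2 hB ⊢
  linear_combination h2 - h1 - hB

theorem dual_unique (Q : ℤ → Fin 2 → ℝ)
    (hQ : ∀ i, det₂ (P.vertex i) (Q i) = 1 ∧ det₂ (fwdDiffSeq P.vertex i) (Q i) = 0) :
    Q = P.dual := by
  funext i
  obtain ⟨h1, h2⟩ := hQ i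
  have h0 := (P.det₂_vertex_pos i).ne'
  simp only [det₂_apply, fwdDiffSeq, Pi.sub_apply] at h0 h1 h2
  ext j
  simp only [dual, det₂_apply, fwdDiffSeq, Pi.sub_apply, Pi.smul_apply, smul_eq_mul]
  field_simp
  fin_cases j
  · simp only [Fin.zero_eta]
    linear_combination P.vertex (i + 1) 0 * h1 - P.vertex i 0 * (h2 + h1)
  · simp only [Fin.mk_one]
    linear_combination P.vertex (i + 1) 1 * h1 - P.vertex i 1 * (h2 + h1)

/-- The evolute transform with respect to `P`, in terms of curvature radii: `sᵢ = αᵢ Δᵢ r`. -/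
noncomputable def evolute : (ℤ → ℝ) →ₗ[ℝ] (ℤ → ℝ) where
  toFun r i := P.α i * fwdDiffSeq r i
  map_add' r s := by funext i; simp only [fwdDiffSeq, Pi.add_apply]; ring
  map_smul' c r := by
    funext i; simp only [fwdDiffSeq, Pi.smul_apply, smul_eq_mul, RingHom.id_apply]; ring

/-- The evolute transform with respect to the dual `Q`, in terms of curvature radii:
`tᵢ = -βᵢ ∇ᵢ s`. -/
noncomputable def dualEvolute : (ℤ → ℝ) →ₗ[ℝ] (ℤ → ℝ) where
  toFun s i := -P.β i * bwdDiffSeq s i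
  map_add' r s := by funext i; simp only [bwdDiffSeq, Pi.add_apply]; ring
  map_smul' c r := by
    funext i; simp only [bwdDiffSeq, Pi.smul_apply, smul_eq_mul, RingHom.id_apply]; ring

/-- The double evolute `tᵢ = -βᵢ ∇ᵢ (αᵢ Δᵢ r)` on all sequences of curvature radii. -/
noncomputable def doubleEvolute : (ℤ → ℝ) →ₗ[ℝ] (ℤ → ℝ) := P.dualEvolute ∘ₗ P.evolute

/-! Traversing `P` `m` times leaves the `ℤ`-indexed sequences of vertices of `P` and `Q` (hence
`α` and `β`) unchanged; the period becomes `2mn`, and the half-period becomes `mn`. -/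

/-- `L_{mP}`: sequences of curvature radii of period `2mn`. -/
def L (_P : SymmetricBall n) (m : ℕ) : Submodule ℝ (ℤ → ℝ) where
  carrier := {r | ∀ i, r (i + 2 * (m * n)) = r i}
  add_mem' hr hs i := by simp [hr i, hs i]
  zero_mem' i := rfl
  smul_mem' c r hr i := by simp [hr i]

/-- `S_{mP}`: the symmetric ones, `rᵢ₊ₘₙ = rᵢ`. -/
def S (_P : SymmetricBall n) (m : ℕ) : Submodule ℝ (ℤ → ℝ) where
  carrier := {r | ∀ i, r (i + m * n) = r i}
  add_mem' hr hs i := by simp [hr i, hs i]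
  zero_mem' i := rfl
  smul_mem' c r hr i := by simp [hr i]

/-- `A_{mP}`: the anti-symmetric ones, `rᵢ₊ₘₙ = -rᵢ`. -/
def A (_P : SymmetricBall n) (m : ℕ) : Submodule ℝ (ℤ → ℝ) where
  carrier := {r | ∀ i, r (i + m * n) = -r i}
  add_mem' hr hs i := by simp [hr i, hs i, add_comm]
  zero_mem' i := by simp
  smul_mem' c r hr i := by simp [hr i]

theorem S_le_L (m : ℕ) : P.S m ≤ P.L m := fun r hr i => by
  have e : i + 2 * ((m : ℤ) * n) = (i + m * n) + m * n := by ring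
  rw [e, hr, hr]

theorem A_le_L (m : ℕ) : P.A m ≤ P.L m := fun r hr i => by
  have e : i + 2 * ((m : ℤ) * n) = (i + m * n) + m * n := by ring
  rw [e, hr, hr, neg_neg]

instance finiteDimensional_L (m : ℕ) [NeZero m] : FiniteDimensional ℝ (P.L m) := by
  have hn := P.two_le
  have hm := NeZero.pos m
  have hN : 0 < 2 * (m * n) := by positivity
  let f : P.L m →ₗ[ℝ] (Fin (2 * (m * n)) → ℝ) :=
    { toFun := fun r i => r.1 (i : ℕ)
      map_add' := fun _ _ => rfl
      map_smul' := fun _ _ => rfl }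
  refine FiniteDimensional.of_injective f ?_
  intro r s h
  apply Subtype.ext
  funext i
  have key : ∀ t : P.L m, t.1 i = t.1 (i % (2 * (m * n) : ℤ)) := by
    intro t
    have hp : Function.Periodic t.1 (2 * (m * n) : ℤ) := t.2
    conv_lhs => rw [← Int.emod_add_mul_ediv i (2 * (m * n) : ℤ), mul_comm _ (i / _)]
    exact (hp.int_mul _) _
  have hN' : (0 : ℤ) < 2 * (m * n) := by exact_mod_cast hN
  have h1 := Int.emod_nonneg i hN'.ne'
  have h2 := Int.emod_lt_of_pos i hN'
  have h3 := congrFun h ⟨(i % (2 * (m * n) : ℤ)).toNat, by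
    have : ((2 * (m * n) : ℕ) : ℤ) = 2 * (m * n) := by push_cast; ring
    omega⟩
  have h4 : r.1 (((i % (2 * (m * n) : ℤ)).toNat : ℕ) : ℤ)
      = s.1 (((i % (2 * (m * n) : ℤ)).toNat : ℕ) : ℤ) := h3
  rw [Int.toNat_of_nonneg h1] at h4
  rw [key r, key s, h4]

instance finiteDimensional_S (m : ℕ) [NeZero m] : FiniteDimensional ℝ (P.S m) :=
  Submodule.finiteDimensional_of_le (P.S_le_L m)

instance finiteDimensional_A (m : ℕ) [NeZero m] : FiniteDimensional ℝ (P.A m) :=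
  Submodule.finiteDimensional_of_le (P.A_le_L m)

theorem β_add (i : ℤ) : P.β (i + n) = P.β i := by
  have e : i + n + 1 = (i + 1) + n := by ring
  simp only [β, e, P.symm, det₂_apply, Pi.neg_apply]
  ring_nf

theorem dual_add (i : ℤ) : P.dual (i + n) = -P.dual i := by
  have e : i + n + 1 = (i + 1) + n := by ring
  ext j
  simp only [dual, fwdDiffSeq, e, P.symm, det₂_apply, Pi.neg_apply, Pi.smul_apply, Pi.sub_apply,
    smul_eq_mul]
  ring_nf

theorem α_add (i : ℤ) : P.α (i + n) = P.α i := by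
  have e : i + n + 1 = (i + 1) + n := by ring
  simp only [α, e, P.dual_add, det₂_apply, Pi.neg_apply]
  ring_nf

theorem α_add_mul (m : ℕ) (i : ℤ) : P.α (i + m * n) = P.α i :=
  Function.Periodic.nat_mul (f := P.α) P.α_add m i

theorem β_add_mul (m : ℕ) (i : ℤ) : P.β (i + m * n) = P.β i :=
  Function.Periodic.nat_mul (f := P.β) P.β_add m i

theorem doubleEvolute_apply (r : ℤ → ℝ) (i : ℤ) :
    P.doubleEvolute r i =
      -P.β i * (P.α i * (r (i + 1) - r i) - P.α (i - 1) * (r i - r (i - 1))) := by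
  simp [doubleEvolute, dualEvolute, evolute, fwdDiffSeq, bwdDiffSeq]

theorem doubleEvolute_shift (m : ℕ) (r : ℤ → ℝ) (i : ℤ) :
    P.doubleEvolute r (i + m * n) = P.doubleEvolute (fun j => r (j + m * n)) i := by
  have e1 : i + (m : ℤ) * n + 1 = (i + 1) + m * n := by ring
  have e2 : i + (m : ℤ) * n - 1 = (i - 1) + m * n := by ring
  simp only [doubleEvolute_apply, e1, e2, α_add_mul, β_add_mul]

theorem doubleEvolute_mem_S (m : ℕ) : ∀ r ∈ P.S m, P.doubleEvolute r ∈ P.S m := by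
  intro r hr i
  have h : (fun j => r (j + m * n)) = r := funext hr
  rw [doubleEvolute_shift, h]

theorem doubleEvolute_mem_A (m : ℕ) : ∀ r ∈ P.A m, P.doubleEvolute r ∈ P.A m := by
  intro r hr i
  have h : (fun j => r (j + m * n)) = -r := funext hr
  rw [doubleEvolute_shift, h, map_neg, Pi.neg_apply]

theorem doubleEvolute_mem_L (m : ℕ) : ∀ r ∈ P.L m, P.doubleEvolute r ∈ P.L m := by
  intro r hr i
  have e : ∀ j : ℤ, j + 2 * ((m : ℤ) * n) = j + ((2 * m : ℕ) : ℤ) * n := by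
    intro j; push_cast; ring
  have h : (fun j => r (j + ((2 * m : ℕ) : ℤ) * n)) = r := by
    funext j
    rw [← e]
    exact hr j
  rw [e, doubleEvolute_shift, h]

/-- The double evolute transform `T_{mP}` of `L_{mP}`. -/
noncomputable def T (m : ℕ) : Module.End ℝ (P.L m) :=
  P.doubleEvolute.restrict (P.doubleEvolute_mem_L m)

/-- The restriction `T_{mP}|_{S_{mP}}`. -/
noncomputable def TS (m : ℕ) : Module.End ℝ (P.S m) :=
  P.doubleEvolute.restrict (P.doubleEvolute_mem_S m)

/-- The restriction `T_{mP}|_{A_{mP}}`. -/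
noncomputable def TA (m : ℕ) : Module.End ℝ (P.A m) :=
  P.doubleEvolute.restrict (P.doubleEvolute_mem_A m)

end SymmetricBall

/-- The vertex at the end of the non-degenerate side number `i` is a cusp: the next non-degenerate
side, number `j` (the sides strictly in between are degenerate and collapse to that vertex), has
the opposite orientation. -/
def IsCuspAfter (r : ℤ → ℝ) (i : ℤ) : Prop :=
  ∃ j, i < j ∧ (∀ k, i < k → k < j → r k = 0) ∧ r i * r j < 0

/-- The number of cusps per period, for a sequence of curvature radii of period `N`. A vertex is
counted through the unique non-degenerate side that arrives at it. -/
noncomputable def cuspCount (N : ℕ) (r : ℤ → ℝ) : ℕ :=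
  {i : ℤ | 0 ≤ i ∧ i < N ∧ IsCuspAfter r i}.ncard

/-- The factor of a characteristic polynomial that belongs to the index `k`, when the eigenvalues
are listed as `σ₀, σ₁¹, σ₁², …, σ_{N-1}¹, σ_{N-1}², σ_N`: one eigenvalue for `k = 0` and for
`k = N`, and two for every other `k`. -/
noncomputable def levelFactor (σ₁ σ₂ : ℕ → ℝ) (N k : ℕ) : Polynomial ℝ :=
  if k = 0 ∨ k = N then Polynomial.X - Polynomial.C (σ₁ k)
  else (Polynomial.X - Polynomial.C (σ₁ k)) * (Polynomial.X - Polynomial.C (σ₂ k))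

/-! ### Combinatorics of cyclic sign changes -/

/-- The number of cusps of `r` among the sides `0, …, b - 1`. -/
noncomputable def cuspsBelow (r : ℤ → ℝ) (b : ℕ) : ℕ :=
  open Classical in Nat.count (fun i : ℕ => IsCuspAfter r i) b

theorem cuspCount_eq_cuspsBelow (N : ℕ) (r : ℤ → ℝ) : cuspCount N r = cuspsBelow r N := by
  classical
  have h : {i : ℤ | 0 ≤ i ∧ i < N ∧ IsCuspAfter r i}
      = (Nat.cast : ℕ → ℤ) '' ((Finset.range N).filter fun i : ℕ => IsCuspAfter r i : Finset ℕ) := by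
    ext i
    simp only [Set.mem_ofPred_eq, Finset.coe_filter, Finset.mem_range, Set.mem_image]
    constructor
    · rintro ⟨h0, h1, h2⟩
      lift i to ℕ using h0
      exact ⟨i, ⟨by exact_mod_cast h1, h2⟩, rfl⟩
    · rintro ⟨j, ⟨h1, h2⟩, rfl⟩
      exact ⟨by positivity, by exact_mod_cast h1, h2⟩
  rw [cuspCount, h, Set.ncard_image_of_injective _ Nat.cast_injective, Set.ncard_coe_finset,
    cuspsBelow, Nat.count_eq_card_filter_range]

theorem IsCuspAfter.ne_zero {r : ℤ → ℝ} {i : ℤ} (h : IsCuspAfter r i) : r i ≠ 0 := by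
  obtain ⟨j, -, -, h⟩ := h
  rintro h0
  simp [h0] at h

theorem cuspsBelow_mono (r : ℤ → ℝ) : Monotone (cuspsBelow r) := by
  classical exact Nat.count_monotone _

theorem cuspsBelow_le_succ (r : ℤ → ℝ) (l : ℕ) : cuspsBelow r (l + 1) ≤ cuspsBelow r l + 1 := by
  classical
  rw [cuspsBelow, cuspsBelow, Nat.count_succ]
  split_ifs <;> omega

theorem cuspsBelow_succ_of_cusp {r : ℤ → ℝ} {l : ℕ} (h : IsCuspAfter r l) :
    cuspsBelow r (l + 1) = cuspsBelow r l + 1 := by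
  classical
  rw [cuspsBelow, cuspsBelow, Nat.count_succ, if_pos h]

theorem cuspsBelow_succ_of_not_cusp {r : ℤ → ℝ} {l : ℕ} (h : ¬ IsCuspAfter r l) :
    cuspsBelow r (l + 1) = cuspsBelow r l := by
  classical
  rw [cuspsBelow, cuspsBelow, Nat.count_succ, if_neg h, add_zero]

theorem cuspsBelow_eq_of_zero {r : ℤ → ℝ} {a b : ℕ} (hab : a ≤ b)
    (h : ∀ k : ℕ, a ≤ k → k < b → r k = 0) : cuspsBelow r b = cuspsBelow r a := by
  induction b, hab using Nat.le_induction with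
  | base => rfl
  | succ b hb ih =>
    rw [cuspsBelow_succ_of_not_cusp fun hc => hc.ne_zero (h b hb b.lt_succ_self),
      ih fun k h1 h2 => h k h1 (by omega)]

theorem isCuspAfter_iff_of_zero {r : ℤ → ℝ} {i j : ℤ} (hij : i < j)
    (h : ∀ k, i < k → k < j → r k = 0) (hj : r j ≠ 0) : IsCuspAfter r i ↔ r i * r j < 0 := by
  refine ⟨?_, fun h' => ⟨j, hij, h, h'⟩⟩
  rintro ⟨l, hl, h1, h2⟩
  rcases lt_trichotomy l j with h3 | rfl | h3
  · simp [h l hl h3] at h2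
  · exact h2
  · exact absurd (h1 j hij h3) hj

theorem exists_last_ne_zero {r : ℤ → ℝ} {a b : ℕ} (hab : a < b) (ha : r a ≠ 0) :
    ∃ l : ℕ, a ≤ l ∧ l < b ∧ r l ≠ 0 ∧ ∀ k : ℕ, l < k → k < b → r k = 0 := by
  induction b, hab using Nat.le_induction with
  | base => exact ⟨a, le_rfl, a.lt_succ_self, ha, fun k h1 h2 => by omega⟩
  | succ b hb ih =>
    by_cases h : r b = 0
    · obtain ⟨l, h1, h2, h3, h4⟩ := ih
      refine ⟨l, h1, by omega, h3, fun k h5 h6 => ?_⟩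
      rcases Nat.lt_succ_iff_lt_or_eq.1 h6 with h7 | rfl
      · exact h4 k h5 h7
      · exact h
    · exact ⟨b, by omega, b.lt_succ_self, h, fun k h1 h2 => by omega⟩

/-- Each cusp flips the sign of the current non-degenerate side and nothing else does, so the signs
at two such sides record the parity of the number of cusps between them. The induction steps back to
the last nonzero side before `b`. -/
theorem cuspsBelow_parity {r : ℤ → ℝ} {a b : ℕ} (hab : a ≤ b) (ha : r a ≠ 0) (hb : r b ≠ 0) :
    0 < (-1) ^ (cuspsBelow r a + cuspsBelow r b) * (r a * r b) := by
  induction b using Nat.strong_induction_on with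
  | _ b ih =>
    rcases hab.eq_or_lt with rfl | hab
    · rw [← two_mul, pow_mul]
      simpa using ha
    obtain ⟨l, h1, h2, h3, h4⟩ := exists_last_ne_zero hab ha
    have hl := ih l h2 h1 h3
    have h4' : ∀ k : ℤ, (l : ℤ) < k → k < b → r k = 0 := by
      intro k hk1 hk2
      lift k to ℕ using by omega
      exact h4 k (by omega) (by omega)
    have hiff := isCuspAfter_iff_of_zero (by exact_mod_cast h2) h4' hb
    have e : cuspsBelow r b = cuspsBelow r (l + 1) :=
      cuspsBelow_eq_of_zero h2 fun k hk1 hk2 => h4 k hk1 hk2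
    have hsq : 0 < r l * r l := mul_self_pos.2 h3
    rw [e]
    by_cases hc : IsCuspAfter r l
    · have hlb := hiff.1 hc
      rw [cuspsBelow_succ_of_cusp hc, ← add_assoc, pow_succ]
      by_contra hn
      have := mul_nonneg_of_nonpos_of_nonpos (not_lt.1 hn) hlb.le
      nlinarith [mul_pos (mul_pos_of_neg_of_neg hlb hlb) hl]
    · have hlb : 0 < r l * r b := lt_of_le_of_ne (not_lt.1 fun h => hc (hiff.2 h))
        (mul_ne_zero h3 hb).symm
      rw [cuspsBelow_succ_of_not_cusp hc]
      have h5 := mul_pos hl hlb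
      have h6 : (-1) ^ (cuspsBelow r a + cuspsBelow r l) * (r a * r l) * (r l * r b)
        = (-1) ^ (cuspsBelow r a + cuspsBelow r l) * (r a * r b) * (r l * r l) := by ring
      rw [h6] at h5
      exact (mul_pos_iff_of_pos_right hsq).1 h5

theorem cuspsBelow_lt_of_mul_neg {r : ℤ → ℝ} {a b : ℕ} (hab : a ≤ b) (h : r a * r b < 0) :
    cuspsBelow r a < cuspsBelow r b := by
  refine lt_of_le_of_ne (cuspsBelow_mono r hab) fun e => ?_
  have := cuspsBelow_parity hab (left_ne_zero_of_mul h.ne) (right_ne_zero_of_mul h.ne)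
  rw [e, ← two_mul, pow_mul] at this
  simp at this
  linarith

theorem cuspsBelow_add_le_of_alternating {r : ℤ → ℝ} {f : ℕ → ℕ} {K : ℕ}
    (h : ∀ j < K, f j < f (j + 1) ∧ r (f j) * r (f (j + 1)) < 0) :
    cuspsBelow r (f 0) + K ≤ cuspsBelow r (f K) := by
  induction K with
  | zero => simp
  | succ K ih =>
    have h1 := ih fun j hj => h j (by omega)
    have h2 := h K (by omega)
    have := cuspsBelow_lt_of_mul_neg h2.1.le h2.2
    omega

theorem isCuspAfter_smul_iff {r : ℤ → ℝ} {c : ℝ} (hc : c ≠ 0) {i : ℤ} :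
    IsCuspAfter (c • r) i ↔ IsCuspAfter r i := by
  have hcc : 0 < c * c := mul_self_pos.2 hc
  have e : ∀ j, (c • r) i * (c • r) j < 0 ↔ r i * r j < 0 := fun j => by
    have : (c • r) i * (c • r) j = c * c * (r i * r j) := by simp; ring
    rw [this]
    exact ⟨fun h => by by_contra h'; nlinarith [mul_nonneg hcc.le (not_lt.1 h')],
      fun h => mul_neg_of_pos_of_neg hcc h⟩
  have e' : ∀ k, (c • r) k = 0 ↔ r k = 0 := fun k => by simp [hc]
  simp only [IsCuspAfter, e, e']

theorem cuspsBelow_smul (r : ℤ → ℝ) {c : ℝ} (hc : c ≠ 0) (b : ℕ) :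
    cuspsBelow (c • r) b = cuspsBelow r b := by
  classical
  unfold cuspsBelow
  congr 1
  funext i
  exact propext (isCuspAfter_smul_iff hc)

theorem isCuspAfter_shift (r : ℤ → ℝ) (i d : ℤ) :
    IsCuspAfter (fun j => r (j + d)) i ↔ IsCuspAfter r (i + d) := by
  constructor
  · rintro ⟨j, h1, h2, h3⟩
    refine ⟨j + d, by omega, fun k hk1 hk2 => ?_, h3⟩
    have := h2 (k - d) (by omega) (by omega)
    simpa using this
  · rintro ⟨j, h1, h2, h3⟩
    refine ⟨j - d, by omega, fun k hk1 hk2 => h2 _ (by omega) (by omega), by simpa using h3⟩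

theorem isCuspAfter_add_iff {r : ℤ → ℝ} {N : ℕ} {c : ℝ} (hc : c ≠ 0)
    (hr : ∀ i, r (i + N) = c * r i) (i : ℤ) : IsCuspAfter r (i + N) ↔ IsCuspAfter r i := by
  rw [← isCuspAfter_shift, show (fun j => r (j + N)) = c • r from funext hr,
    isCuspAfter_smul_iff hc]

/-- Scaling by `c ≠ 0` preserves cusps, so one statement serves both the periodic case `c = 1` and
the antiperiodic case `c = -1`. -/
theorem cuspsBelow_add {r : ℤ → ℝ} {N : ℕ} {c : ℝ} (hc : c ≠ 0)
    (hr : ∀ i, r (i + N) = c * r i) (a : ℕ) :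
    cuspsBelow r (a + N) = cuspsBelow r a + cuspsBelow r N := by
  classical
  rw [add_comm a, cuspsBelow, Nat.count_add, add_comm, cuspsBelow, cuspsBelow]
  congr 2
  funext k
  push_cast
  rw [add_comm, isCuspAfter_add_iff hc hr]

theorem cuspsBelow_mul {r : ℤ → ℝ} {N : ℕ} {c : ℝ} (hc : c ≠ 0)
    (hr : ∀ i, r (i + N) = c * r i) (k : ℕ) :
    cuspsBelow r (k * N) = k * cuspsBelow r N := by
  induction k with
  | zero => simp [cuspsBelow]
  | succ k ih => rw [add_mul, one_mul, cuspsBelow_add hc hr, ih, add_mul, one_mul]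

theorem exists_natCast_ne_zero {r : ℤ → ℝ} {N : ℕ} (hN : 0 < N) {c : ℝ}
    (hr : ∀ i, r (i + N) = c * r i) (h0 : r ≠ 0) : ∃ a : ℕ, r a ≠ 0 := by
  by_contra! h
  have key : ∀ k : ℕ, ∀ i : ℤ, 0 ≤ i + k * N → c ^ k * r i = 0 := by
    intro k
    induction k with
    | zero =>
      intro i hi
      lift i to ℕ using by simpa using hi
      simp [h]
    | succ k ih =>
      intro i hi
      have := ih (i + N) (by push_cast at hi ⊢; linarith)
      rw [hr] at this
      rw [pow_succ, mul_assoc]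
      exact this
  have hc : c ≠ 0 := by
    rintro rfl
    apply h0
    funext i
    have := hr (i - N)
    simpa using this
  apply h0
  funext i
  have := key i.natAbs i (by
    have : (1 : ℤ) ≤ N := by exact_mod_cast hN
    nlinarith [abs_nonneg i, neg_abs_le i, Int.natCast_natAbs i])
  simpa [hc] using this

theorem even_cuspsBelow_of_periodic {r : ℤ → ℝ} {N : ℕ} (hN : 0 < N)
    (hr : ∀ i, r (i + N) = r i) : Even (cuspsBelow r N) := by
  have hr' : ∀ i, r (i + N) = 1 * r i := by simpa using hr
  by_cases h0 : r = 0
  · have : cuspsBelow r N = cuspsBelow r 0 := cuspsBelow_eq_of_zero N.zero_le (by simp [h0])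
    rw [this]
    classical exact ⟨0, Nat.count_zero _⟩
  obtain ⟨a, ha⟩ := exists_natCast_ne_zero hN hr' h0
  have := cuspsBelow_parity (Nat.le_add_right a N) ha (by push_cast; rwa [hr])
  rw [cuspsBelow_add one_ne_zero hr', ← add_assoc, ← two_mul, pow_add, pow_mul] at this
  push_cast at this
  rw [hr] at this
  by_contra ho
  rw [(Nat.not_even_iff_odd.1 ho).neg_one_pow] at this
  simp at this
  nlinarith [mul_self_nonneg (r a)]

theorem odd_cuspsBelow_of_antiperiodic {r : ℤ → ℝ} {N : ℕ} (hN : 0 < N)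
    (hr : ∀ i, r (i + N) = -r i) (h0 : r ≠ 0) : Odd (cuspsBelow r N) := by
  have hr' : ∀ i, r (i + N) = (-1) * r i := by simpa using hr
  obtain ⟨a, ha⟩ := exists_natCast_ne_zero hN hr' h0
  have := cuspsBelow_parity (Nat.le_add_right a N) ha (by push_cast; rw [hr]; simpa)
  rw [cuspsBelow_add (by norm_num) hr', ← add_assoc, ← two_mul, pow_add, pow_mul] at this
  push_cast at this
  rw [hr] at this
  by_contra ho
  rw [(Nat.not_odd_iff_even.1 ho).neg_one_pow] at this
  simp at this
  nlinarith [mul_self_nonneg (r a)]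

/-- The function `f` enumerates all cusps on the natural numbers. Shifting the first cusp by a
period gives the cusp whose number is the count per period, so the alternation closes up cyclically.
-/
theorem exists_alternating {r : ℤ → ℝ} {N : ℕ} (hN : 0 < N) (hr : ∀ i, r (i + N) = r i)
    (h : cuspsBelow r N ≠ 0) :
    ∃ f : ℕ → ℕ, f (cuspsBelow r N) = f 0 + N ∧
      ∀ j, f j < f (j + 1) ∧ r (f j) * r (f (j + 1)) < 0 := by
  classical
  have hr' : ∀ i, r (i + N) = 1 * r i := by simpa using hr
  set p : ℕ → Prop := fun i => IsCuspAfter r i with hp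
  -- If all cusps were at most `B`, the count could never exceed `B + 1`, but `B + 2` periods
  -- contain at least `B + 2` cusps.
  have hinf : (Set.ofPred p).Infinite := by
    refine Set.infinite_of_not_bddAbove fun ⟨B, hB⟩ => ?_
    have h1 : cuspsBelow r ((B + 2) * N) ≤ B + 1 := by
      have : ∀ c, cuspsBelow r (B + 1 + c) ≤ B + 1 := by
        intro c
        induction c with
        | zero => exact Nat.count_le _
        | succ c ih =>
          rw [← add_assoc, cuspsBelow_succ_of_not_cusp]
          · exact ih
          · intro hc
            have := hB (show p (B + 1 + c) from hc)
            omega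
      have h2 : B + 1 ≤ (B + 2) * N := by nlinarith
      obtain ⟨c, hc⟩ := Nat.exists_eq_add_of_le h2
      rw [hc]
      exact this c
    rw [cuspsBelow_mul one_ne_zero hr'] at h1
    have : 1 ≤ cuspsBelow r N := Nat.one_le_iff_ne_zero.2 h
    nlinarith
  have hcount : ∀ j, cuspsBelow r (Nat.nth p j) = j := fun j => Nat.count_nth_of_infinite hinf j
  refine ⟨Nat.nth p, ?_, fun j => ⟨Nat.nth_strictMono hinf j.lt_succ_self, ?_⟩⟩
  · have h1 : cuspsBelow r (Nat.nth p 0 + N) = cuspsBelow r N := by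
      rw [cuspsBelow_add one_ne_zero hr', hcount, zero_add]
    have h2 : p (Nat.nth p 0 + N) := by
      have := Nat.nth_mem_of_infinite hinf 0
      simp only [hp] at this ⊢
      push_cast
      rwa [isCuspAfter_add_iff one_ne_zero hr']
    rw [← h1]
    exact Nat.nth_count h2
  · have h1 : ∀ j, r (Nat.nth p j) ≠ 0 := fun j =>
      IsCuspAfter.ne_zero (Nat.nth_mem_of_infinite hinf j)
    have := cuspsBelow_parity (Nat.nth_strictMono hinf j.lt_succ_self).le (h1 j) (h1 (j + 1))
    rw [hcount, hcount, Nat.succ_eq_add_one, ← add_assoc, ← two_mul, pow_succ, pow_mul] at this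
    simpa using this

/-! ### Rolle's principle and stability of the cusp count -/

/-- A discrete Rolle argument: `s` takes, between any two indices at which `r` has opposite signs,
the sign dictated by the later one. -/
theorem cuspsBelow_le_of_rolle {r s : ℤ → ℝ} {N : ℕ} (hN : 0 < N) (hr : ∀ i, r (i + N) = r i)
    (hs : ∀ i, s (i + N) = s i) (δ : ℕ) (η : ℝ)
    (h : ∀ a b : ℕ, a < b → r a * r b < 0 →
      ∃ k, a + δ ≤ k ∧ k < b + δ ∧ 0 < η * (s k * r b)) :
    cuspsBelow r N ≤ cuspsBelow s N := by
  by_cases h0 : cuspsBelow r N = 0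
  · omega
  obtain ⟨f, hf, halt⟩ := exists_alternating hN hr h0
  set K := cuspsBelow r N with hK
  choose k hk1 hk2 hk3 using fun j => h _ _ (halt j).1 (halt j).2
  -- The last Rolle point is replaced by the first one shifted by a period, so that the `K`
  -- alternations of `s` fill exactly one period.
  let g : ℕ → ℕ := fun j => if j < K then k j else k 0 + N
  have hsign : ∀ x y u v : ℝ, 0 < η * (x * u) → 0 < η * (y * v) → u * v < 0 → x * y < 0 := by
    intro x y u v h1 h2 h3
    by_contra h4
    have h5 := mul_pos h1 h2
    have h6 : η * (x * u) * (η * (y * v)) = (η * η * (x * y)) * (u * v) := by ring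
    have h7 : 0 ≤ η * η * (x * y) := mul_nonneg (mul_self_nonneg _) (not_lt.1 h4)
    nlinarith [mul_nonneg_of_nonpos_of_nonpos h3.le (neg_nonpos.2 h7)]
  have hg0 : g 0 = k 0 := by simp [g, Nat.pos_of_ne_zero h0]
  have hgK : g K = k 0 + N := by simp [g]
  have key := cuspsBelow_add_le_of_alternating (r := s) (f := g) (K := K) (by
    intro j hj
    have hj1 : g j = k j := if_pos hj
    rw [hj1]
    by_cases hj2 : j + 1 < K
    · have hj3 : g (j + 1) = k (j + 1) := if_pos hj2
      rw [hj3]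
      exact ⟨(hk2 j).trans_le (hk1 (j + 1)), hsign _ _ _ _ (hk3 j) (hk3 (j + 1)) (halt (j + 1)).2⟩
    · have hj3 : g (j + 1) = k 0 + N := if_neg hj2
      have hj4 : j + 1 = K := by omega
      rw [hj3]
      refine ⟨?_, ?_⟩
      · have := hk2 j
        rw [hj4, hf] at this
        have := hk1 0
        omega
      · push_cast
        rw [hs]
        refine hsign _ _ _ _ (hk3 j) (hk3 0) ?_
        rw [hj4, hf]
        push_cast
        rw [hr]
        exact (halt 0).2)
  rw [hg0, hgK, cuspsBelow_add (c := 1) one_ne_zero (by simpa using hs)] at key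
  omega

/-- Near a sequence without multiple zeros the number of cusps is constant. -/
theorem cuspsBelow_eq_of_same_sign {r s : ℤ → ℝ} {N : ℕ} (hN : 0 < N)
    (hr : ∀ i, r (i + N) = r i) (hs : ∀ i, s (i + N) = s i) (h0 : r ≠ 0)
    (hz : ∀ i, r i = 0 → r (i - 1) * r (i + 1) < 0) (h : ∀ i, r i ≠ 0 → 0 < r i * s i) :
    cuspsBelow s N = cuspsBelow r N := by
  obtain ⟨a, ha⟩ := exists_natCast_ne_zero hN (c := 1) (by simpa using hr) h0
  have hmul : ∀ i j, r i * r j < 0 → s i * s j < 0 := by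
    intro i j hij
    have h1 := h i (left_ne_zero_of_mul hij.ne)
    have h2 := h j (right_ne_zero_of_mul hij.ne)
    by_contra h3
    nlinarith [mul_pos h1 h2, mul_nonneg (neg_nonneg.2 hij.le) (not_lt.1 h3)]
  have hmul' : ∀ i j, 0 < r i * r j → 0 < s i * s j := by
    intro i j hij
    have h1 := h i (left_ne_zero_of_mul hij.ne')
    have h2 := h j (right_ne_zero_of_mul hij.ne')
    by_contra h3
    nlinarith [mul_pos h1 h2, mul_nonneg hij.le (neg_nonneg.2 (not_lt.1 h3))]
  have hs0 : ∀ i, r i ≠ 0 → s i ≠ 0 := fun i hi => right_ne_zero_of_mul (h i hi).ne'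
  have key : ∀ b : ℕ, a ≤ b → r b ≠ 0 →
      cuspsBelow s b + cuspsBelow r a = cuspsBelow r b + cuspsBelow s a := by
    intro b
    induction b using Nat.strong_induction_on with
    | _ b ih =>
      intro hab hb
      rcases hab.eq_or_lt with rfl | hab
      · ring
      obtain ⟨c, rfl⟩ : ∃ c, b = c + 1 := ⟨b - 1, by omega⟩
      by_cases hc : r c = 0
      · have hca : c ≠ a := by rintro rfl; exact ha hc
        obtain ⟨d, rfl⟩ : ∃ d, c = d + 1 := ⟨c - 1, by omega⟩
        have hd := hz _ hc
        push_cast at hd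
        rw [show (d : ℤ) + 1 - 1 = d by ring] at hd
        have hd0 := left_ne_zero_of_mul hd.ne
        have h1 := ih d (by omega) (by omega) hd0
        have h2 : cuspsBelow r (d + 1 + 1) = cuspsBelow r d + 1 := by
          rw [cuspsBelow_succ_of_not_cusp fun hcusp => hcusp.ne_zero hc, cuspsBelow_succ_of_cusp]
          refine ⟨d + 1 + 1, by omega, fun k hk1 hk2 => ?_, hd⟩
          rw [show k = ((d + 1 : ℕ) : ℤ) by push_cast; omega, hc]
        -- Whatever the sign of `s` at the zero of `r`, two steps across it contain at least one
        -- cusp and at most two, and parity rules out two.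
        have h3 : cuspsBelow s (d + 1 + 1) = cuspsBelow s d + 1 := by
          have h4 := cuspsBelow_le_succ s d
          have h5 := cuspsBelow_le_succ s (d + 1)
          have h6 := cuspsBelow_lt_of_mul_neg (r := s) (a := d) (b := d + 1 + 1) (by omega)
            (by push_cast; exact hmul _ _ hd)
          have h7 := cuspsBelow_parity (r := s) (a := d) (b := d + 1 + 1) (by omega)
            (hs0 _ hd0) (hs0 _ hb)
          by_contra h8
          have h9 : cuspsBelow s (d + 1 + 1) = cuspsBelow s d + 2 := by omega
          have h10 : s d * s ((d + 1 + 1 : ℕ) : ℤ) < 0 := by push_cast; exact hmul _ _ hd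
          rw [h9, ← add_assoc, ← two_mul, pow_add, pow_mul] at h7
          simp only [even_two, Even.neg_pow, one_pow, one_mul] at h7
          linarith
        omega
      · have h1 := ih c (by omega) (by omega) hc
        have hcc : ∀ k : ℤ, (c : ℤ) < k → k < ((c + 1 : ℕ) : ℤ) → False := by
          intro k hk1 hk2
          push_cast at hk2
          omega
        have hcl : (c : ℤ) < ((c + 1 : ℕ) : ℤ) := by push_cast; omega
        have hr1 := isCuspAfter_iff_of_zero hcl (fun k h1 h2 => (hcc k h1 h2).elim) hb
        have hs1 := isCuspAfter_iff_of_zero hcl (fun k h1 h2 => (hcc k h1 h2).elim) (hs0 _ hb)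
        by_cases hcusp : r c * r ((c + 1 : ℕ) : ℤ) < 0
        · rw [cuspsBelow_succ_of_cusp (hr1.2 hcusp), cuspsBelow_succ_of_cusp (hs1.2 (hmul _ _ hcusp))]
          omega
        · have hpos := hmul' _ _ (lt_of_le_of_ne (not_lt.1 hcusp) (mul_ne_zero hc hb).symm)
          rw [cuspsBelow_succ_of_not_cusp fun h => hcusp (hr1.1 h),
            cuspsBelow_succ_of_not_cusp fun h => hpos.not_gt (hs1.1 h)]
          omega
  have := key (a + N) (by omega) (by push_cast; rwa [hr])
  rw [cuspsBelow_add (c := 1) one_ne_zero (by simpa using hs),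
    cuspsBelow_add (c := 1) one_ne_zero (by simpa using hr)] at this
  omega

theorem periodic_emod {r : ℤ → ℝ} {N : ℕ} (hr : ∀ i, r (i + N) = r i) (i : ℤ) :
    r (i % N) = r i := by
  have hp : Function.Periodic r (N : ℤ) := hr
  conv_rhs => rw [← Int.emod_add_mul_ediv i (N : ℤ), mul_comm _ (i / _)]
  exact ((hp.int_mul _) _).symm

open Filter Topology in
theorem eventually_cuspsBelow_eq {ι : Type*} {l : Filter ι} {F : ι → ℤ → ℝ} {r : ℤ → ℝ} {N : ℕ}
    (hN : 0 < N) (hr : ∀ i, r (i + N) = r i) (hF : ∀ k i, F k (i + N) = F k i) (h0 : r ≠ 0)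
    (hz : ∀ i, r i = 0 → r (i - 1) * r (i + 1) < 0)
    (h : ∀ i, Tendsto (fun k => F k i) l (𝓝 (r i))) :
    ∀ᶠ k in l, cuspsBelow (F k) N = cuspsBelow r N := by
  have h1 : ∀ᶠ k in l, ∀ i ∈ Finset.range N, r (i : ℤ) ≠ 0 → 0 < r i * F k i := by
    rw [Filter.eventually_all_finset]
    intro i _
    by_cases hi : r (i : ℤ) = 0
    · simp [hi]
    have := (h i).const_mul (r i)
    filter_upwards [this.eventually (lt_mem_nhds (mul_self_pos.2 hi))] with k hk _ using hk
  filter_upwards [h1] with k hk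
  refine cuspsBelow_eq_of_same_sign hN hr (hF k) h0 hz fun i hi => ?_
  have hN' : (0 : ℤ) < N := by exact_mod_cast hN
  have e1 := Int.emod_nonneg i hN'.ne'
  have e2 := Int.emod_lt_of_pos i hN'
  have := hk (i % N).toNat (by rw [Finset.mem_range]; omega)
  rw [Int.toNat_of_nonneg e1, periodic_emod hr, periodic_emod (hF k)] at this
  exact this hi

/-! ### Linear algebra of eigenbases and coordinate functionals -/

theorem exists_sorted_eigenbasis {V : Type*} [AddCommGroup V] [Module ℝ V] [FiniteDimensional ℝ V]
    (B : V →ₗ[ℝ] V →ₗ[ℝ] ℝ) (hsymm : ∀ x y, B x y = B y x) (hpos : ∀ x, x ≠ 0 → 0 < B x x)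
    (T : V →ₗ[ℝ] V) (hT : ∀ x y, B (T x) y = B x (T y)) {d : ℕ} (hd : Module.finrank ℝ V = d) :
    ∃ (b : Module.Basis (Fin d) ℝ V) (μ : Fin d → ℝ), Monotone μ ∧ ∀ i, T (b i) = μ i • b i := by
  let core : InnerProductSpace.Core ℝ V :=
    { inner := fun x y => B x y
      conj_inner_symm := fun x y => by simp [hsymm x y]
      re_inner_nonneg := fun x => by
        by_cases hx : x = 0
        · simp [hx]
        · exact (hpos x hx).le
      add_left := fun x y z => by simp
      smul_left := fun x y c => by simp
      definite := fun x hx => by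
        by_contra h
        exact (hpos x h).ne' hx }
  let : NormedAddCommGroup V := core.toNormedAddCommGroup
  let : InnerProductSpace ℝ V := InnerProductSpace.ofCore core.toCore
  -- The sequence `eigenvalues` is antitone, so `-T` is diagonalized to obtain an increasing list
  -- for `T`.
  have hS : (-T).IsSymmetric := fun x y => by
    change B (-T x) y = B x (-T y)
    simp [hT]
  refine ⟨(hS.eigenvectorBasis hd).toBasis, fun i => -hS.eigenvalues hd i,
    fun i j hij => neg_le_neg (hS.eigenvalues_antitone hd hij), fun i => ?_⟩
  have := hS.apply_eigenvectorBasis hd i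
  simp only [LinearMap.neg_apply, RCLike.ofReal_real_eq_id, id] at this
  simp only [OrthonormalBasis.coe_toBasis, neg_smul, ← this, neg_neg]

section Eigenbasis

variable {V ι : Type*} [AddCommGroup V] [Module ℝ V] [Fintype ι]
  (b : Module.Basis ι ℝ V) {T : V →ₗ[ℝ] V} {μ : ι → ℝ}

theorem charpoly_eq_prod_of_eigenbasis (hb : ∀ i, T (b i) = μ i • b i) :
    haveI := Module.Finite.of_basis b; haveI := Module.Free.of_basis b
    T.charpoly = ∏ i, (Polynomial.X - Polynomial.C (μ i)) := by
  classical
  have := Module.Finite.of_basis b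
  have := Module.Free.of_basis b
  have h : T.toMatrix b b = Matrix.diagonal μ := by
    ext i j
    by_cases hij : i = j
    · subst hij; simp [LinearMap.toMatrix_apply, hb]
    · simp [LinearMap.toMatrix_apply, hb, hij]
  rw [← T.charpoly_toMatrix b, h, Matrix.charpoly_diagonal]

omit [Fintype ι] in
theorem iSup_eigenspace_eq_top_of_eigenbasis (hb : ∀ i, T (b i) = μ i • b i) :
    ⨆ c : ℝ, Module.End.eigenspace T c = ⊤ := by
  rw [eq_top_iff, ← b.span_eq, Submodule.span_le]
  rintro _ ⟨i, rfl⟩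
  exact Submodule.mem_iSup_of_mem (μ i) (Module.End.mem_eigenspace_iff.2 (hb i))

theorem repr_apply_of_eigenbasis (hb : ∀ i, T (b i) = μ i • b i) (x : V) (i : ι) :
    b.repr (T x) i = μ i * b.repr x i := by
  classical
  conv_lhs => rw [← b.sum_repr x]
  simp only [map_sum, map_smul, hb, Finsupp.coe_finsetSum, Finset.sum_apply, Finsupp.smul_apply,
    Module.Basis.repr_self, smul_eq_mul]
  rw [Finset.sum_eq_single i]
  · simp; ring
  · intro j _ hj
    simp [hj]
  · simp

theorem eigenvalue_eq_of_repr_ne_zero (hb : ∀ i, T (b i) = μ i • b i) {x : V} {c : ℝ}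
    (hx : T x = c • x) {i : ι} (hi : b.repr x i ≠ 0) : μ i = c := by
  have h := repr_apply_of_eigenbasis b hb x i
  rw [hx] at h
  simp only [map_smul, Finsupp.smul_apply, smul_eq_mul] at h
  exact (mul_right_cancel₀ hi h).symm

theorem pow_apply_sum_eigenbasis (hb : ∀ i, T (b i) = μ i • b i) (c : ι → ℝ) (k : ℕ) :
    (T ^ k) (∑ i, c i • b i) = ∑ i, (μ i ^ k * c i) • b i := by
  induction k with
  | zero => simp
  | succ k ih =>
    rw [pow_succ', Module.End.mul_apply, ih, map_sum]
    refine Finset.sum_congr rfl fun i _ => ?_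
    rw [map_smul, hb, smul_smul]
    ring_nf

end Eigenbasis

/-- Functionals that separate points span the dual, so a maximal independent subfamily has exactly
`d` members and evaluates isomorphically. This permits prescribing values, in particular alternating
signs, at `d` coordinates. -/
theorem exists_strictMono_surjective_eval {V : Type*} [AddCommGroup V] [Module ℝ V]
    [FiniteDimensional ℝ V] {d N : ℕ} (hd : Module.finrank ℝ V = d)
    (φ : Fin N → Module.Dual ℝ V) (hφ : ∀ x, (∀ i, φ i x = 0) → x = 0) :
    ∃ f : Fin d → Fin N, StrictMono f ∧ ∀ y : Fin d → ℝ, ∃ x, ∀ i, φ (f i) x = y i := by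
  classical
  obtain ⟨κ, a, ha, hspan, hli⟩ := exists_linearIndependent' ℝ φ
  have : Fintype κ := Fintype.ofInjective a ha
  let ev : V →ₗ[ℝ] (κ → ℝ) := LinearMap.pi fun k => φ (a k)
  have hinj : Function.Injective ev := by
    rw [← LinearMap.ker_eq_bot, LinearMap.ker_eq_bot']
    intro x hx
    refine hφ x fun i => ?_
    have hi : φ i ∈ Submodule.span ℝ (Set.range (φ ∘ a)) := by
      rw [hspan]; exact Submodule.subset_span ⟨i, rfl⟩
    generalize φ i = χ at hi
    induction hi using Submodule.span_induction with
    | mem ψ hψ => obtain ⟨k, rfl⟩ := hψ; exact congrFun hx k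
    | zero => rfl
    | add _ _ _ _ h1 h2 => simp [h1, h2]
    | smul c _ _ h => simp [h]
  have h1 : Fintype.card κ ≤ d := by
    have := hli.fintype_card_le_finrank
    rwa [Subspace.dual_finrank_eq, hd] at this
  have h2 : d ≤ Fintype.card κ := by
    have := LinearMap.finrank_le_finrank_of_injective hinj
    rwa [Module.finrank_fintype_fun_eq_card, hd] at this
  have hsurj : Function.Surjective ev :=
    (LinearMap.injective_iff_surjective_of_finrank_eq_finrank (by
      rw [Module.finrank_fintype_fun_eq_card, hd]; omega)).1 hinj
  let s : Finset (Fin N) := Finset.univ.image a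
  have hs : s.card = d := by
    rw [Finset.card_image_of_injective _ ha, Finset.card_univ]; omega
  refine ⟨s.orderEmbOfFin hs, (s.orderEmbOfFin hs).strictMono, fun y => ?_⟩
  have hmem : ∀ k, a k ∈ s := fun k => Finset.mem_image_of_mem _ (Finset.mem_univ k)
  obtain ⟨x, hx⟩ := hsurj fun k => y ((s.orderIsoOfFin hs).symm ⟨a k, hmem k⟩)
  refine ⟨x, fun i => ?_⟩
  obtain ⟨k, -, hk⟩ := Finset.mem_image.1 (s.orderEmbOfFin_mem hs i)
  have := congrFun hx k
  rw [← hk]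
  refine this.trans ?_
  congr 1
  rw [OrderIso.symm_apply_eq]
  exact Subtype.ext hk

/-! ### The double evolute: positivity, Rolle, zeros of eigenvectors, symmetry -/

namespace SymmetricBall

variable {n : ℕ} (P : SymmetricBall n)

theorem det₂_edge_pos (i : ℤ) :
    0 < det₂ (fwdDiffSeq P.vertex i) (fwdDiffSeq P.vertex (i + 1)) := by
  have hn := P.two_le
  have h := P.convex i (i + 1 + 1)
    (by
      intro h
      have h1 := Int.modEq_iff_dvd.1 h.symm
      have e : i + 1 + 1 - i = 2 := by ring
      rw [e] at h1
      have := Int.le_of_dvd (by norm_num) h1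
      omega)
    (by
      intro h
      have h1 := Int.modEq_iff_dvd.1 h.symm
      have e : i + 1 + 1 - (i + 1) = 1 := by ring
      rw [e] at h1
      have := Int.le_of_dvd (by norm_num) h1
      omega)
  simp only [det₂_apply, fwdDiffSeq, Pi.sub_apply] at h ⊢
  linarith

theorem β_pos (i : ℤ) : 0 < P.β i := one_div_pos.2 (P.det₂_vertex_pos i)

theorem dual_eq (i : ℤ) : P.dual i = P.β i • fwdDiffSeq P.vertex i := rfl

theorem α_pos (i : ℤ) : 0 < P.α i := by
  refine one_div_pos.2 ?_
  have h := mul_pos (mul_pos (P.β_pos i) (P.β_pos (i + 1))) (P.det₂_edge_pos i)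
  rw [dual_eq, dual_eq]
  simp only [det₂_apply, Pi.smul_apply, smul_eq_mul] at h ⊢
  linarith

variable {P}

theorem periodic_of_mem_L {m : ℕ} {r : ℤ → ℝ} (hr : r ∈ P.L m) (i : ℤ) :
    r (i + ((2 * (m * n) : ℕ) : ℤ)) = r i := by
  push_cast
  exact hr i

variable (P)

theorem evolute_mem_L (m : ℕ) {r : ℤ → ℝ} (hr : r ∈ P.L m) : P.evolute r ∈ P.L m := by
  intro i
  have e : ∀ j : ℤ, j + 2 * ((m : ℤ) * n) = j + ((2 * m : ℕ) : ℤ) * n := by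
    intro j; push_cast; ring
  have e1 : i + 2 * ((m : ℤ) * n) + 1 = (i + 1) + 2 * (m * n) := by ring
  change P.α _ * (r _ - r _) = P.α i * (r (i + 1) - r i)
  rw [e1, hr, hr, e, P.α_add_mul]

theorem period_pos {n : ℕ} (P : SymmetricBall n) (m : ℕ) [NeZero m] : 0 < 2 * (m * n) := by
  have := P.two_le
  have := NeZero.pos m
  positivity

theorem exists_pos_fwdDiffSeq {r : ℤ → ℝ} {ε : ℝ} {a b : ℕ} (hab : a ≤ b)
    (h : 0 < ε * (r b - r a)) : ∃ k : ℕ, a ≤ k ∧ k < b ∧ 0 < ε * (r (k + 1) - r k) := by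
  induction b, hab using Nat.le_induction with
  | base => simp at h
  | succ b hb ih =>
    by_cases h1 : 0 < ε * (r (b + 1) - r b)
    · exact ⟨b, hb, b.lt_succ_self, h1⟩
    · obtain ⟨k, h2, h3, h4⟩ := ih (by push_cast at h; nlinarith)
      exact ⟨k, h2, by omega, h4⟩

theorem exists_fwdDiffSeq_of_mul_neg {r : ℤ → ℝ} {a b : ℕ} (hab : a < b) (h : r a * r b < 0) :
    ∃ k : ℕ, a ≤ k ∧ k < b ∧ 0 < (r (k + 1) - r k) * r b := by
  obtain ⟨k, h1, h2, h3⟩ := exists_pos_fwdDiffSeq (r := r) (ε := r b) hab.le (by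
    have := right_ne_zero_of_mul h.ne
    nlinarith [mul_self_nonneg (r b)])
  exact ⟨k, h1, h2, by linarith⟩

/-- Between two sides of opposite sign some difference points towards the later sign. Since `α` and
`β` are positive, Rolle's principle applies to both evolute steps. -/
theorem cuspsBelow_le_doubleEvolute {m : ℕ} [NeZero m] {r : ℤ → ℝ} (hr : r ∈ P.L m) :
    cuspsBelow r (2 * (m * n)) ≤ cuspsBelow (P.doubleEvolute r) (2 * (m * n)) := by
  have h1 : cuspsBelow r (2 * (m * n)) ≤ cuspsBelow (P.evolute r) (2 * (m * n)) := by
    refine cuspsBelow_le_of_rolle (P.period_pos m) (periodic_of_mem_L hr)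
      (periodic_of_mem_L (P.evolute_mem_L m hr)) 0 1 fun a b hab h => ?_
    obtain ⟨k, h1, h2, h3⟩ := exists_fwdDiffSeq_of_mul_neg hab h
    refine ⟨k, h1, h2, ?_⟩
    have h4 := mul_pos (P.α_pos k) h3
    change 0 < 1 * (P.α k * (r (k + 1) - r k) * r b)
    linarith
  refine h1.trans ?_
  set s := P.evolute r with hs
  -- A backward difference at `k + 1` is the forward difference at `k`, hence the shift `1`; the
  -- factor `-1` absorbs the sign in `-βᵢ ∇ᵢ`.
  refine cuspsBelow_le_of_rolle (P.period_pos m) (periodic_of_mem_L (P.evolute_mem_L m hr))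
      (periodic_of_mem_L (P.doubleEvolute_mem_L m r hr)) 1 (-1) fun a b hab h => ?_
  obtain ⟨k, h1, h2, h3⟩ := exists_fwdDiffSeq_of_mul_neg hab h
  refine ⟨k + 1, by omega, by omega, ?_⟩
  have h4 := mul_pos (P.β_pos ((k + 1 : ℕ) : ℤ)) h3
  change 0 < -1 * (-P.β _ * (s _ - s (((k + 1 : ℕ) : ℤ) - 1)) * s b)
  have e : ((k + 1 : ℕ) : ℤ) - 1 = k := by push_cast; ring
  rw [e]
  push_cast at h4 ⊢
  linarith

theorem cuspsBelow_le_T_pow {m : ℕ} [NeZero m] (r : P.L m) (k : ℕ) :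
    cuspsBelow r (2 * (m * n)) ≤ cuspsBelow ((P.T m ^ k) r : P.L m) (2 * (m * n)) := by
  induction k with
  | zero => rfl
  | succ k ih =>
    rw [pow_succ', Module.End.mul_apply]
    exact ih.trans (P.cuspsBelow_le_doubleEvolute ((P.T m ^ k) r).2)

theorem T_coe {m : ℕ} (r : P.L m) : ((P.T m r : P.L m) : ℤ → ℝ) = P.doubleEvolute r := rfl

/-- The eigenvalue equation is a second-order recurrence whose leading coefficient `αᵢ βᵢ` is
nonzero: two consecutive zeros propagate forwards, and periodicity covers the other indices. -/
theorem eq_zero_of_consecutive_zeros {m : ℕ} [NeZero m] {r : ℤ → ℝ} (hr : r ∈ P.L m) {μ : ℝ}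
    (hT : P.doubleEvolute r = μ • r) {i : ℤ} (h0 : r i = 0) (h1 : r (i + 1) = 0) : r = 0 := by
  have key : ∀ k : ℕ, r (i + k) = 0 ∧ r (i + k + 1) = 0 := by
    intro k
    induction k with
    | zero => simpa using ⟨h0, h1⟩
    | succ k ih =>
      push_cast
      rw [← add_assoc]
      refine ⟨ih.2, ?_⟩
      have := congrFun hT (i + k + 1)
      rw [P.doubleEvolute_apply, Pi.smul_apply, ih.2, add_sub_cancel_right, ih.1] at this
      simpa [(P.α_pos _).ne', (P.β_pos _).ne'] using this
  funext j
  have hN := P.period_pos m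
  have e := (key ((j - i) % ((2 * (m * n) : ℕ) : ℤ)).toNat).1
  rw [Int.toNat_of_nonneg (Int.emod_nonneg _ (by exact_mod_cast hN.ne'))] at e
  have := periodic_emod (r := fun k => r (i + k)) (N := 2 * (m * n))
    (fun k => by rw [← add_assoc]; exact periodic_of_mem_L hr _) (j - i)
  simp only [e, add_sub_cancel] at this
  exact this.symm

/-- At a zero the recurrence reduces to `αᵢ rᵢ₊₁ = -αᵢ₋₁ rᵢ₋₁`, with both sides nonzero. -/
theorem mul_neg_of_eigenvector {m : ℕ} [NeZero m] {r : P.L m} {μ : ℝ} (h0 : r ≠ 0)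
    (hT : P.T m r = μ • r) (i : ℤ) (hi : (r : ℤ → ℝ) i = 0) :
    (r : ℤ → ℝ) (i - 1) * (r : ℤ → ℝ) (i + 1) < 0 := by
  have hT' : P.doubleEvolute (r : ℤ → ℝ) = μ • (r : ℤ → ℝ) := congrArg Subtype.val hT
  have h1 : (r : ℤ → ℝ) (i - 1) ≠ 0 := fun h => h0 (Subtype.ext
    (P.eq_zero_of_consecutive_zeros r.2 hT' h (by rwa [sub_add_cancel])))
  have h2 := congrFun hT' i
  rw [P.doubleEvolute_apply, Pi.smul_apply, hi] at h2
  have h3 : P.α i * (r : ℤ → ℝ) (i + 1) + P.α (i - 1) * (r : ℤ → ℝ) (i - 1) = 0 := by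
    have := (P.β_pos i).ne'
    have h4 : P.β i * (P.α i * (r : ℤ → ℝ) (i + 1) + P.α (i - 1) * (r : ℤ → ℝ) (i - 1)) = 0 := by
      simp only [smul_zero] at h2
      linarith
    simpa [this] using h4
  have h5 := mul_pos (P.α_pos (i - 1)) (mul_self_pos.2 h1)
  have h6 : P.α i * ((r : ℤ → ℝ) (i - 1) * (r : ℤ → ℝ) (i + 1)) < 0 := by
    have : P.α i * ((r : ℤ → ℝ) (i - 1) * (r : ℤ → ℝ) (i + 1))
      = -(P.α (i - 1) * ((r : ℤ → ℝ) (i - 1) * (r : ℤ → ℝ) (i - 1))) := by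
      linear_combination (r : ℤ → ℝ) (i - 1) * h3
    linarith
  by_contra h
  exact h6.not_ge (mul_nonneg (P.α_pos i).le (not_lt.1 h))

open Filter Topology in
theorem eventually_cuspsBelow_eq_eigenvector {m : ℕ} [NeZero m] {ι : Type*} {l : Filter ι}
    {F : ι → P.L m} {r : P.L m} {μ : ℝ} (h0 : r ≠ 0) (hT : P.T m r = μ • r)
    (h : ∀ i, Tendsto (fun k => (F k : ℤ → ℝ) i) l (𝓝 ((r : ℤ → ℝ) i))) :
    ∀ᶠ k in l, cuspsBelow (F k) (2 * (m * n)) = cuspsBelow r (2 * (m * n)) :=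
  eventually_cuspsBelow_eq (P.period_pos m) (periodic_of_mem_L r.2)
    (fun k => periodic_of_mem_L (F k).2) (fun h => h0 (Subtype.ext h))
    (P.mul_neg_of_eigenvector h0 hT) h

/-- Along the line through `u` and `v` the count is locally constant as long as the vector is
nonzero, and the line is connected. If the line meets `0`, the two vectors are proportional. -/
theorem cuspsBelow_eq_of_eigenspace {m : ℕ} [NeZero m] {u v : P.L m} {μ : ℝ} (hu : u ≠ 0)
    (hv : v ≠ 0) (hTu : P.T m u = μ • u) (hTv : P.T m v = μ • v) :
    cuspsBelow u (2 * (m * n)) = cuspsBelow v (2 * (m * n)) := by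
  by_cases hz : ∃ t : ℝ, u + t • (v - u) = 0
  · obtain ⟨t, ht⟩ := hz
    have h1 : (t - 1) • u = t • v := by
      have : (t - 1) • u = t • v - (u + t • (v - u)) := by module
      rw [this, ht, sub_zero]
    have ht0 : t ≠ 0 := by
      rintro rfl
      simp at h1
      exact hu h1
    have ht1 : t - 1 ≠ 0 := by
      intro h
      rw [h, zero_smul] at h1
      exact (smul_ne_zero ht0 hv) h1.symm
    rw [← cuspsBelow_smul u ht1, ← cuspsBelow_smul v ht0]
    exact congrArg (fun w : P.L m => cuspsBelow w (2 * (m * n))) h1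
  · push Not at hz
    have hlc : IsLocallyConstant fun t : ℝ =>
        cuspsBelow (u + t • (v - u) : P.L m) (2 * (m * n)) := by
      rw [IsLocallyConstant.iff_eventually_eq]
      intro t
      refine P.eventually_cuspsBelow_eq_eigenvector (μ := μ) (hz t) ?_ fun i => ?_
      · rw [map_add, map_smul, map_sub, hTu, hTv]
        module
      · have : Continuous fun t : ℝ => ((u + t • (v - u) : P.L m) : ℤ → ℝ) i := by
          simp only [Submodule.coe_add, Submodule.coe_smul, Submodule.coe_sub, Pi.add_apply,
            Pi.smul_apply, Pi.sub_apply, smul_eq_mul]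
          fun_prop
        exact this.tendsto t
    have := hlc.apply_eq_of_isPreconnected isPreconnected_univ (Set.mem_univ 0) (Set.mem_univ 1)
    simpa using this

/-- The form `∑ rᵢ sᵢ / βᵢ` with respect to which the double evolute transform is symmetric. -/
noncomputable def form (m : ℕ) : P.L m →ₗ[ℝ] P.L m →ₗ[ℝ] ℝ :=
  LinearMap.mk₂ ℝ
    (fun r s => ∑ i ∈ Finset.range (2 * (m * n)), (r : ℤ → ℝ) i * (s : ℤ → ℝ) i / P.β i)
    (fun r r' s => by
      rw [← Finset.sum_add_distrib]
      refine Finset.sum_congr rfl fun i _ => ?_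
      simp only [Submodule.coe_add, Pi.add_apply]
      ring)
    (fun c r s => by
      rw [Finset.smul_sum]
      refine Finset.sum_congr rfl fun i _ => ?_
      simp only [Submodule.coe_smul, Pi.smul_apply, smul_eq_mul]
      ring)
    (fun r s s' => by
      rw [← Finset.sum_add_distrib]
      refine Finset.sum_congr rfl fun i _ => ?_
      simp only [Submodule.coe_add, Pi.add_apply]
      ring)
    (fun c r s => by
      rw [Finset.smul_sum]
      refine Finset.sum_congr rfl fun i _ => ?_
      simp only [Submodule.coe_smul, Pi.smul_apply, smul_eq_mul]
      ring)

theorem form_apply {m : ℕ} (r s : P.L m) : P.form m r s =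
    ∑ i ∈ Finset.range (2 * (m * n)), (r : ℤ → ℝ) i * (s : ℤ → ℝ) i / P.β i := rfl

theorem form_comm {m : ℕ} (r s : P.L m) : P.form m r s = P.form m s r := by
  simp only [form_apply, mul_comm]

theorem eq_zero_of_range {m : ℕ} [NeZero m] {r : ℤ → ℝ} (hr : r ∈ P.L m)
    (h : ∀ i < 2 * (m * n), r (i : ℕ) = 0) : r = 0 := by
  funext i
  have hN := P.period_pos m
  have e1 := Int.emod_nonneg i (b := ((2 * (m * n) : ℕ) : ℤ)) (by exact_mod_cast hN.ne')
  have e2 := Int.emod_lt_of_pos i (b := ((2 * (m * n) : ℕ) : ℤ)) (by exact_mod_cast hN)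
  have := h (i % ((2 * (m * n) : ℕ) : ℤ)).toNat (by omega)
  rwa [Int.toNat_of_nonneg e1, periodic_emod (periodic_of_mem_L hr)] at this

theorem form_pos {m : ℕ} [NeZero m] (r : P.L m) (h : r ≠ 0) : 0 < P.form m r r := by
  have hnn : ∀ i ∈ Finset.range (2 * (m * n)),
      0 ≤ (r : ℤ → ℝ) (i : ℕ) * (r : ℤ → ℝ) (i : ℕ) / P.β i :=
    fun i _ => div_nonneg (mul_self_nonneg _) (P.β_pos i).le
  refine lt_of_le_of_ne (Finset.sum_nonneg hnn) fun h0 => h (Subtype.ext ?_)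
  have h1 := (Finset.sum_eq_zero_iff_of_nonneg hnn).1 h0.symm
  refine P.eq_zero_of_range r.2 fun i hi => ?_
  have := h1 i (Finset.mem_range.2 hi)
  simpa [(P.β_pos i).ne'] using this

theorem form_T {m : ℕ} (r s : P.L m) : P.form m (P.T m r) s =
    ∑ i ∈ Finset.range (2 * (m * n)), P.α i *
      (((r : ℤ → ℝ) (i + 1) - (r : ℤ → ℝ) i) * ((s : ℤ → ℝ) (i + 1) - (s : ℤ → ℝ) i)) := by
  -- The boundary term of summation by parts; its increments sum to zero over a period.
  set g : ℕ → ℝ := fun i => P.evolute r (i - 1) * (s : ℤ → ℝ) i with hg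
  have htel : ∑ i ∈ Finset.range (2 * (m * n)), (g (i + 1) - g i) = 0 := by
    rw [Finset.sum_range_sub, sub_eq_zero]
    have h1 := periodic_of_mem_L (P.evolute_mem_L m r.2) (-1)
    have h2 := periodic_of_mem_L s.2 0
    simp only [hg]
    rw [zero_add] at h2
    rw [neg_add_eq_sub] at h1
    rw [h1, h2]
    simp
  rw [form_apply, ← add_zero (Finset.sum _ _), ← htel, ← Finset.sum_add_distrib]
  refine Finset.sum_congr rfl fun i _ => ?_
  have hb := (P.β_pos i).ne'
  rw [T_coe, P.doubleEvolute_apply]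
  simp only [hg, evolute, fwdDiffSeq, LinearMap.coe_mk, AddHom.coe_mk]
  push_cast
  rw [add_sub_cancel_right, sub_add_cancel]
  field_simp
  ring

theorem form_T_comm {m : ℕ} (r s : P.L m) :
    P.form m (P.T m r) s = P.form m r (P.T m s) := by
  rw [P.form_comm r, form_T, form_T]
  exact Finset.sum_congr rfl fun i _ => by ring

theorem eigenvalue_nonneg {m : ℕ} [NeZero m] {r : P.L m} {μ : ℝ} (h0 : r ≠ 0)
    (hT : P.T m r = μ • r) : 0 ≤ μ := by
  have h1 : 0 ≤ P.form m (P.T m r) r := by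
    rw [form_T]
    exact Finset.sum_nonneg fun i _ => mul_nonneg (P.α_pos i).le (mul_self_nonneg _)
  rw [hT, map_smul, LinearMap.smul_apply, smul_eq_mul] at h1
  exact nonneg_of_mul_nonneg_left h1 (P.form_pos r h0)

theorem finrank_L (m : ℕ) [NeZero m] : Module.finrank ℝ (P.L m) = 2 * (m * n) := by
  have hN := P.period_pos m
  have hN' : (0 : ℤ) < ((2 * (m * n) : ℕ) : ℤ) := by exact_mod_cast hN
  let f : P.L m →ₗ[ℝ] (Fin (2 * (m * n)) → ℝ) :=
    { toFun := fun r i => (r : ℤ → ℝ) (i : ℕ)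
      map_add' := fun _ _ => rfl
      map_smul' := fun _ _ => rfl }
  have hf : Function.Bijective f := by
    constructor
    · rw [← LinearMap.ker_eq_bot, LinearMap.ker_eq_bot']
      intro r hr
      exact Subtype.ext (P.eq_zero_of_range r.2 fun i hi => congrFun hr ⟨i, hi⟩)
    · intro g
      refine ⟨⟨fun i => g ⟨(i % ((2 * (m * n) : ℕ) : ℤ)).toNat, ?_⟩, ?_⟩, ?_⟩
      · have e1 := Int.emod_nonneg i hN'.ne'
        have e2 := Int.emod_lt_of_pos i hN'
        omega
      · intro i
        have : (i + 2 * ((m : ℤ) * n)) % ((2 * (m * n) : ℕ) : ℤ) = i % ((2 * (m * n) : ℕ) : ℤ) := by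
          push_cast
          exact Int.add_emod_right _ _
        simp only [this]
      · funext i
        change g _ = g i
        congr 1
        apply Fin.ext
        change (((i : ℕ) : ℤ) % ((2 * (m * n) : ℕ) : ℤ)).toNat = i
        rw [Int.emod_eq_of_lt (by positivity) (by exact_mod_cast i.2)]
        simp
  rw [(LinearEquiv.ofBijective f hf).finrank_eq, Module.finrank_fintype_fun_eq_card, Fintype.card_fin]

theorem exists_eigenbasis (m : ℕ) [NeZero m] :
    ∃ (b : Module.Basis (Fin (2 * (m * n))) ℝ (P.L m)) (μ : Fin (2 * (m * n)) → ℝ),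
      Monotone μ ∧ ∀ i, P.T m (b i) = μ i • b i :=
  exists_sorted_eigenbasis (P.form m) P.form_comm P.form_pos (P.T m) P.form_T_comm
    (P.finrank_L m)

end SymmetricBall

/-! ### Cusp counts of the sorted eigenvectors -/

namespace SymmetricBall

variable {n : ℕ} (P : SymmetricBall n)

theorem one_mem_L (m : ℕ) : (1 : ℤ → ℝ) ∈ P.L m := fun _ => rfl

theorem T_one (m : ℕ) : P.T m ⟨1, P.one_mem_L m⟩ = (0 : ℝ) • ⟨1, P.one_mem_L m⟩ := by
  apply Subtype.ext
  funext i
  rw [T_coe, doubleEvolute_apply]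
  simp

theorem cuspsBelow_one (b : ℕ) : cuspsBelow 1 b = 0 := by
  induction b with
  | zero => classical exact Nat.count_zero _
  | succ b ih =>
    rw [cuspsBelow_succ_of_not_cusp, ih]
    rintro ⟨j, -, -, h⟩
    simp at h
    linarith

theorem cuspsBelow_of_ker {m : ℕ} [NeZero m] {r : P.L m} (h0 : r ≠ 0)
    (hT : P.T m r = (0 : ℝ) • r) : cuspsBelow r (2 * (m * n)) = 0 := by
  rw [P.cuspsBelow_eq_of_eigenspace h0 (v := ⟨1, P.one_mem_L m⟩)
    (fun h => one_ne_zero (congrArg Subtype.val h)) hT (P.T_one m)]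
  exact cuspsBelow_one _

theorem coe_sum_smul {m : ℕ} {ι : Type*} (s : Finset ι) (x : ι → ℝ) (v : ι → P.L m) (j : ℤ) :
    ((∑ i ∈ s, x i • v i : P.L m) : ℤ → ℝ) j = ∑ i ∈ s, x i * (v i : ℤ → ℝ) j := by
  rw [Submodule.coe_sum, Finset.sum_apply]
  rfl

section Eigenbasis

variable {P} {m : ℕ} [NeZero m] {b : Module.Basis (Fin (2 * (m * n))) ℝ (P.L m)}
  {μ : Fin (2 * (m * n)) → ℝ} (hb : ∀ i, P.T m (b i) = μ i • b i)

include hb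

-- The combinations converge to their part with `ρ i = 1`, which is an eigenvector for `μ i₀`;
-- stability of its cusps makes the count eventually constant.
open Filter Topology in
theorem eventually_cuspsBelow_sum_eq {c ρ : Fin (2 * (m * n)) → ℝ} {i₀ : Fin (2 * (m * n))}
    (hc : c i₀ ≠ 0) (hi₀ : ρ i₀ = 1)
    (hρ : ∀ i, c i ≠ 0 → 0 ≤ ρ i ∧ ρ i ≤ 1 ∧ (ρ i = 1 → μ i = μ i₀)) :
    ∀ᶠ k : ℕ in atTop, cuspsBelow (∑ i, (ρ i ^ k * c i) • b i : P.L m) (2 * (m * n))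
      = cuspsBelow (b i₀) (2 * (m * n)) := by
  classical
  set r : P.L m := ∑ i, (if ρ i = 1 then c i else 0) • b i with hr
  have h0 : r ≠ 0 := by
    intro h
    have := congrArg (fun x => b.repr x i₀) h
    simp only [hr, b.repr_sum_self, map_zero, Finsupp.zero_apply, hi₀, if_true] at this
    exact hc this
  have hT : P.T m r = μ i₀ • r := by
    rw [hr, map_sum, Finset.smul_sum]
    refine Finset.sum_congr rfl fun i _ => ?_
    rw [map_smul, hb, smul_comm]
    split_ifs with h
    · by_cases hi : c i = 0
      · simp [hi]
      · rw [(hρ i hi).2.2 h]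
    · simp
  rw [← P.cuspsBelow_eq_of_eigenspace h0 (b.ne_zero i₀) hT (hb i₀)]
  refine P.eventually_cuspsBelow_eq_eigenvector h0 hT fun j => ?_
  simp only [hr, coe_sum_smul]
  refine tendsto_finsetSum _ fun i _ => Tendsto.mul_const _ ?_
  by_cases hi : c i = 0
  · simp [hi]
  split_ifs with h
  · simp [h]
  · have := (tendsto_pow_atTop_nhds_zero_of_lt_one (hρ i hi).1
      (lt_of_le_of_ne (hρ i hi).2.1 h)).mul_const (c i)
    simpa using this

/-- Power iteration: the rescaled iterates of `T` converge to the top component of `r`, and cusps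
are not lost on the way. If the top eigenvalue is `0`, then `r` itself lies in the kernel. -/
theorem cuspsBelow_le_of_top {r : P.L m} {i₀ : Fin (2 * (m * n))} (hi₀ : b.repr r i₀ ≠ 0)
    (hmax : ∀ i, b.repr r i ≠ 0 → μ i ≤ μ i₀) :
    cuspsBelow r (2 * (m * n)) ≤ cuspsBelow (b i₀) (2 * (m * n)) := by
  have hnn : ∀ i, 0 ≤ μ i := fun i => P.eigenvalue_nonneg (b.ne_zero i) (hb i)
  have hpow := fun k => pow_apply_sum_eigenbasis b hb (fun i => b.repr r i) k
  rw [b.sum_repr] at hpow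
  rcases (hnn i₀).eq_or_lt with h | h
  · have h0 : r ≠ 0 := by
      rintro rfl
      simp at hi₀
    refine (P.cuspsBelow_eq_of_eigenspace h0 (b.ne_zero i₀) ?_ (hb i₀)).le
    have := hpow 1
    rw [pow_one] at this
    rw [this, ← h, zero_smul]
    refine Finset.sum_eq_zero fun i _ => ?_
    by_cases hi : b.repr r i = 0
    · simp [hi]
    · have : μ i = 0 := le_antisymm (h ▸ hmax i hi) (hnn i)
      simp [this]
  · obtain ⟨k, hk⟩ := (eventually_cuspsBelow_sum_eq hb (ρ := fun i => μ i / μ i₀) hi₀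
      (div_self h.ne') fun i hi => ⟨div_nonneg (hnn i) h.le, (div_le_one h).2 (hmax i hi),
        fun h1 => by rwa [div_eq_one_iff_eq h.ne'] at h1⟩).exists
    have e : ∑ i, ((μ i / μ i₀) ^ k * b.repr r i) • b i = (μ i₀ ^ k)⁻¹ • (P.T m ^ k) r := by
      rw [hpow, Finset.smul_sum]
      refine Finset.sum_congr rfl fun i _ => ?_
      rw [smul_smul, div_pow]
      congr 1
      ring
    rw [e, Submodule.coe_smul, cuspsBelow_smul _ (inv_ne_zero (pow_ne_zero _ h.ne'))] at hk
    rw [← hk]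
    exact P.cuspsBelow_le_T_pow r k

/-- Power iteration backwards: on the eigenvectors occurring in `r` the operator is invertible, the
rescaled preimages of `r` converge to the bottom component, and `T ^ k` carries them back to a
multiple of `r`. -/
theorem cuspsBelow_ge_of_bot {r : P.L m} {i₀ : Fin (2 * (m * n))} (hi₀ : b.repr r i₀ ≠ 0)
    (hmin : ∀ i, b.repr r i ≠ 0 → μ i₀ ≤ μ i) :
    cuspsBelow (b i₀) (2 * (m * n)) ≤ cuspsBelow r (2 * (m * n)) := by
  rcases (P.eigenvalue_nonneg (b.ne_zero i₀) (hb i₀)).eq_or_lt with h | h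
  · rw [P.cuspsBelow_of_ker (b.ne_zero i₀) (by rw [h]; exact hb i₀)]
    exact Nat.zero_le _
  · have hpos : ∀ i, b.repr r i ≠ 0 → 0 < μ i := fun i hi => h.trans_le (hmin i hi)
    obtain ⟨k, hk⟩ := (eventually_cuspsBelow_sum_eq hb (ρ := fun i => μ i₀ / μ i) hi₀
      (div_self h.ne') fun i hi => ⟨div_nonneg h.le (hpos i hi).le,
        (div_le_one (hpos i hi)).2 (hmin i hi),
        fun h1 => by rw [div_eq_one_iff_eq (hpos i hi).ne'] at h1; exact h1.symm⟩).exists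
    rw [← hk]
    refine (P.cuspsBelow_le_T_pow _ k).trans_eq ?_
    rw [pow_apply_sum_eigenbasis b hb]
    have e : ∑ i, (μ i ^ k * ((μ i₀ / μ i) ^ k * b.repr r i)) • b i = (μ i₀ ^ k) • r := by
      conv_rhs => rw [← b.sum_repr r, Finset.smul_sum]
      refine Finset.sum_congr rfl fun i _ => ?_
      rw [smul_smul]
      by_cases hi : b.repr r i = 0
      · simp [hi]
      · rw [div_pow, ← mul_assoc, mul_div_cancel₀ _ (pow_ne_zero _ (hpos i hi).ne')]
    rw [e, Submodule.coe_smul, cuspsBelow_smul _ (pow_ne_zero _ h.ne')]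

theorem cuspsBelow_mono_of_eigenvalue_le {i j : Fin (2 * (m * n))} (h : μ i ≤ μ j) :
    cuspsBelow (b i) (2 * (m * n)) ≤ cuspsBelow (b j) (2 * (m * n)) := by
  rcases h.eq_or_lt with h | h
  · exact (P.cuspsBelow_eq_of_eigenspace (b.ne_zero i) (b.ne_zero j) (hb i) (h ▸ hb j)).le
  have hij : i ≠ j := by rintro rfl; exact h.false
  have hrepr : ∀ k, b.repr (b i + b j) k ≠ 0 → k = i ∨ k = j := by
    intro k hk
    by_contra! hc
    simp [hc.1.symm, hc.2.symm] at hk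
  have h1 : b.repr (b i + b j) i ≠ 0 := by simp [hij.symm]
  have h2 : b.repr (b i + b j) j ≠ 0 := by simp [hij]
  -- The count for `b i + b j` lies between the counts for `b i` and `b j`.
  refine (cuspsBelow_ge_of_bot hb h1 ?_).trans (cuspsBelow_le_of_top hb h2 ?_)
  · intro k hk
    rcases hrepr k hk with rfl | rfl
    exacts [le_rfl, h.le]
  · intro k hk
    rcases hrepr k hk with rfl | rfl
    exacts [h.le, le_rfl]

theorem exists_cuspsBelow_bounds {d : ℕ} (e : Fin d → Fin (2 * (m * n))) (x : Fin d → ℝ)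
    (h : ∑ k, x k • b (e k) ≠ 0) :
    (∃ k, cuspsBelow (∑ k, x k • b (e k) : P.L m) (2 * (m * n))
      ≤ cuspsBelow (b (e k)) (2 * (m * n))) ∧
    ∃ k, cuspsBelow (b (e k)) (2 * (m * n))
      ≤ cuspsBelow (∑ k, x k • b (e k) : P.L m) (2 * (m * n)) := by
  set r := ∑ k, x k • b (e k) with hr
  have hrepr : ∀ i, b.repr r i ≠ 0 → ∃ k, e k = i := by
    intro i hi
    by_contra! hc
    apply hi
    simp only [hr, map_sum, map_smul, Finsupp.coe_finsetSum, Finset.sum_apply,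
      Finsupp.smul_apply, Module.Basis.repr_self]
    exact Finset.sum_eq_zero fun k _ => by simp [hc k]
  have hne : (b.repr r).support.Nonempty := by simpa using h
  constructor
  · obtain ⟨i, hi, hmax⟩ := (b.repr r).support.exists_max_image μ hne
    rw [Finsupp.mem_support_iff] at hi
    obtain ⟨k, rfl⟩ := hrepr i hi
    exact ⟨k, cuspsBelow_le_of_top hb hi fun i hi => hmax i (Finsupp.mem_support_iff.2 hi)⟩
  · obtain ⟨i, hi, hmin⟩ := (b.repr r).support.exists_min_image μ hne
    rw [Finsupp.mem_support_iff] at hi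
    obtain ⟨k, rfl⟩ := hrepr i hi
    exact ⟨k, cuspsBelow_ge_of_bot hb hi fun i hi => hmin i (Finsupp.mem_support_iff.2 hi)⟩

/-- Some combination of eigenvectors `0, …, j` alternates in sign at `j + 1` sides, so it has at
least `j` cusps, and none of these eigenvectors has more cusps than `b j`. -/
theorem le_cuspsBelow_eigenbasis (hμ : Monotone μ) (j : Fin (2 * (m * n))) :
    (j : ℕ) ≤ cuspsBelow (b j) (2 * (m * n)) := by
  let e : Fin (j + 1) → Fin (2 * (m * n)) := Fin.castLE j.2
  let Φ : (Fin (j + 1) → ℝ) →ₗ[ℝ] P.L m := Fintype.linearCombination ℝ fun k => b (e k)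
  have hΦ : ∀ x, Φ x = ∑ k, x k • b (e k) := fun x => rfl
  have hinj : Function.Injective Φ := by
    have : LinearIndependent ℝ fun k => b (e k) :=
      b.linearIndependent.comp e (Fin.castLE_injective _)
    exact this.fintypeLinearCombination_injective
  let φ : Fin (2 * (m * n)) → Module.Dual ℝ (Fin (j + 1) → ℝ) := fun i =>
    LinearMap.proj ((i : ℕ) : ℤ) ∘ₗ (P.L m).subtype ∘ₗ Φ
  obtain ⟨f, hf, hy⟩ := exists_strictMono_surjective_eval (d := j + 1) (by simp) φ fun x hx =>
    hinj (by
      rw [map_zero]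
      exact Subtype.ext (P.eq_zero_of_range (Φ x).2 fun i hi => hx ⟨i, hi⟩))
  obtain ⟨x, hx⟩ := hy fun i => (-1) ^ (i : ℕ)
  have hx' : ∀ i, (Φ x : ℤ → ℝ) (f i : ℕ) = (-1) ^ (i : ℕ) := hx
  have h0 : Φ x ≠ 0 := by
    intro h
    have := hx' 0
    rw [h] at this
    simp at this
  obtain ⟨k, hk⟩ := (exists_cuspsBelow_bounds hb e x h0).1
  refine le_trans ?_ (hk.trans (cuspsBelow_mono_of_eigenvalue_le hb (hμ ?_)))
  · change (j : ℕ) ≤ cuspsBelow (Φ x) _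
    let g : ℕ → ℕ := fun i => if h : i < (j : ℕ) + 1 then f ⟨i, h⟩ else 0
    have hg : ∀ i (h : i < (j : ℕ) + 1), g i = f ⟨i, h⟩ := fun i h => dif_pos h
    have := cuspsBelow_add_le_of_alternating (r := Φ x) (f := g) (K := j) fun i hi => by
      rw [hg i (by omega), hg (i + 1) (by omega), hx', hx']
      refine ⟨hf (by simp), ?_⟩
      rw [← pow_add, ← add_assoc, ← two_mul, pow_succ, pow_mul]
      norm_num
    have h2 : g j ≤ 2 * (m * n) := by
      rw [hg _ (by omega)]
      exact (f _).2.le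
    exact (Nat.le_add_left _ _).trans (this.trans (cuspsBelow_mono _ h2))
  · exact Fin.mk_le_mk.2 (Nat.lt_succ_iff.1 k.2)

theorem cuspsBelow_eigenbasis_le (hμ : Monotone μ) (j : Fin (2 * (m * n))) :
    cuspsBelow (b j) (2 * (m * n)) ≤ j + 1 := by
  by_contra! hz
  let d := 2 * (m * n) - j
  have hd : j + d = 2 * (m * n) := by omega
  let e : Fin d → Fin (2 * (m * n)) := fun k => ⟨j + k, by omega⟩
  have he : Function.Injective e := fun k l h => by
    have := congrArg Fin.val h
    exact Fin.ext (by simpa [e] using this)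
  let Φ : (Fin d → ℝ) →ₗ[ℝ] P.L m := Fintype.linearCombination ℝ fun k => b (e k)
  have hinj : Function.Injective Φ := by
    have : LinearIndependent ℝ fun k => b (e k) := b.linearIndependent.comp e he
    exact this.fintypeLinearCombination_injective
  let ψ : (Fin d → ℝ) →ₗ[ℝ] (Fin (d - 1) → ℝ) := LinearMap.pi fun i =>
    LinearMap.proj ((j + 1 + i : ℕ) : ℤ) ∘ₗ (P.L m).subtype ∘ₗ Φ
  have hker : LinearMap.ker ψ ≠ ⊥ := LinearMap.ker_ne_bot_of_finrank_lt (by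
    simp only [Module.finrank_fintype_fun_eq_card, Fintype.card_fin]
    omega)
  obtain ⟨x, hx, hx0⟩ := (Submodule.ne_bot_iff _).1 hker
  have h0 : Φ x ≠ 0 := fun h => hx0 (hinj (by rw [h, map_zero]))
  obtain ⟨k, hk⟩ := (exists_cuspsBelow_bounds hb e x h0).2
  change _ ≤ cuspsBelow (Φ x) _ at hk
  have h1 : cuspsBelow (Φ x) (2 * (m * n)) = cuspsBelow (Φ x) (j + 1) := by
    refine cuspsBelow_eq_of_zero (by omega) fun i hi1 hi2 => ?_
    have := congrFun hx ⟨i - (j + 1), by omega⟩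
    have e1 : (j : ℕ) + 1 + (i - (j + 1)) = i := by omega
    change (Φ x : ℤ → ℝ) ((j + 1 + (i - (j + 1)) : ℕ) : ℤ) = 0 at this
    rwa [e1] at this
  have h2 : cuspsBelow (Φ x) (j + 1) ≤ j + 1 := by classical exact Nat.count_le _
  have h3 : cuspsBelow (b j) (2 * (m * n)) ≤ cuspsBelow (b (e k)) (2 * (m * n)) :=
    cuspsBelow_mono_of_eigenvalue_le hb (hμ (Fin.mk_le_mk.2 (Nat.le_add_right _ _)))
  omega

theorem cuspsBelow_eigenbasis (hμ : Monotone μ) (j : Fin (2 * (m * n))) :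
    cuspsBelow (b j) (2 * (m * n)) = 2 * (((j : ℕ) + 1) / 2) := by
  have h1 := le_cuspsBelow_eigenbasis hb hμ j
  have h2 := cuspsBelow_eigenbasis_le hb hμ j
  have h3 := even_cuspsBelow_of_periodic (P.period_pos m) (periodic_of_mem_L (b j).2)
  obtain ⟨k, hk⟩ := h3
  omega

end Eigenbasis

end SymmetricBall

/-! ### The eigenvalues 1 and 0 -/

namespace SymmetricBall

variable {n : ℕ} (P : SymmetricBall n)

theorem α_smul_fwdDiffSeq_dual (i : ℤ) :
    P.α i • fwdDiffSeq P.dual i = -P.vertex (i + 1) := by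
  have hD : det₂ (P.dual i) (P.dual (i + 1)) ≠ 0 := fun h => by
    have := P.α_pos i
    simp [α, h] at this
  have h1 := (P.dual_spec i).1
  have h2 := (P.dual_spec i).2.1
  have h3 := (P.dual_spec (i + 1)).1
  unfold α
  simp only [det₂_apply, fwdDiffSeq, Pi.sub_apply] at h1 h2 h3 hD ⊢
  have h4 : P.vertex (i + 1) 0 * P.dual i 1 - P.dual i 0 * P.vertex (i + 1) 1 = 1 := by
    linear_combination h1 + h2
  ext j
  simp only [Pi.smul_apply, Pi.sub_apply, Pi.neg_apply, smul_eq_mul]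
  field_simp
  fin_cases j
  · simp only [Fin.zero_eta]
    linear_combination P.dual i 0 * h3 - P.dual (i + 1) 0 * h4
  · simp only [Fin.mk_one]
    linear_combination P.dual i 1 * h3 - P.dual (i + 1) 1 * h4

/-- The curvature radii `[v, Qᵢ]`. -/
noncomputable def linearRadii (v : Fin 2 → ℝ) (i : ℤ) : ℝ := det₂ v (P.dual i)

theorem linearRadii_add (v : Fin 2 → ℝ) (i : ℤ) :
    P.linearRadii v (i + n) = -P.linearRadii v i := by
  simp only [linearRadii, P.dual_add, det₂_apply, Pi.neg_apply]
  ring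

theorem linearRadii_mem_L (v : Fin 2 → ℝ) (m : ℕ) : P.linearRadii v ∈ P.L m := by
  have h : Function.Periodic (P.linearRadii v) (2 * (n : ℤ)) := fun i => by
    rw [two_mul, ← add_assoc, linearRadii_add, linearRadii_add, neg_neg]
  intro i
  have := h.nat_mul m i
  rwa [show (m : ℤ) * (2 * n) = 2 * (m * n) by ring] at this

/-- By duality the first step sends `[v, Qᵢ]` to `-[v, Pᵢ₊₁]`, and the second returns `[v, βᵢ Δᵢ P]
= [v, Qᵢ]`. -/
theorem doubleEvolute_linearRadii (v : Fin 2 → ℝ) :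
    P.doubleEvolute (P.linearRadii v) = P.linearRadii v := by
  have h : ∀ i, P.α i * (P.linearRadii v (i + 1) - P.linearRadii v i)
      = -det₂ v (P.vertex (i + 1)) := by
    intro i
    have h0 := congrFun (P.α_smul_fwdDiffSeq_dual i) 0
    have h1 := congrFun (P.α_smul_fwdDiffSeq_dual i) 1
    simp only [linearRadii, det₂_apply, fwdDiffSeq, Pi.smul_apply, Pi.sub_apply, Pi.neg_apply,
      smul_eq_mul] at h0 h1 ⊢
    linear_combination v 0 * h1 - v 1 * h0
  funext i
  have h1 := h (i - 1)
  rw [sub_add_cancel] at h1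
  rw [doubleEvolute_apply, h, h1, linearRadii, dual_eq]
  simp only [det₂_apply, fwdDiffSeq, Pi.smul_apply, Pi.sub_apply, smul_eq_mul]
  ring

theorem convex_of_lt {i j : ℤ} (h1 : i + 1 < j) (h2 : j < i + 2 * n) :
    0 < det₂ (fwdDiffSeq P.vertex i) (P.vertex j - P.vertex i) := by
  refine P.convex i j (fun h => ?_) (fun h => ?_)
  · have := Int.le_of_dvd (by omega) (Int.modEq_iff_dvd.1 h.symm)
    omega
  · have := Int.le_of_dvd (by omega) (Int.modEq_iff_dvd.1 h.symm)
    omega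

/-- The sides `1, …, n - 1` of a symmetric convex `2n`-gon turn left of side `0`. -/
theorem det₂_edge_zero_pos (i : ℕ) (h1 : i + 1 < n) :
    0 < det₂ (fwdDiffSeq P.vertex 0) (fwdDiffSeq P.vertex (i + 1)) := by
  induction i with
  | zero => simpa using P.det₂_edge_pos 0
  | succ i ih =>
    have ih := ih (by omega)
    push_cast
    have hD := P.det₂_edge_pos (i + 1)
    have hw := P.convex_of_lt (i := 0) (j := (i + 1 + 1) + n) (by omega) (by omega)
    have ha := P.convex_of_lt (i := i + 1) (j := n) (by omega) (by omega)
    have hb : 0 ≤ det₂ (fwdDiffSeq P.vertex (i + 1 + 1)) (P.vertex n - P.vertex (i + 1 + 1)) := by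
      rcases (show i + 1 + 1 + 1 ≤ n by omega).eq_or_lt with h | h
      · have e : (n : ℤ) = i + 1 + 1 + 1 := by omega
        rw [e]
        simp only [det₂_apply, fwdDiffSeq, Pi.sub_apply]
        exact le_of_eq (by ring)
      · exact (P.convex_of_lt (by omega) (by omega)).le
    have hn := P.symm 0
    rw [zero_add] at hn
    rw [P.symm] at hw
    rw [hn] at ha hb
    simp only [det₂_apply, fwdDiffSeq, Pi.sub_apply, Pi.neg_apply, zero_add] at ih hD hw ha hb ⊢
    -- With `a`, `b`, `c` the sides `0`, `i + 1`, `i + 2` and `w = Pₙ - Pᵢ₊₂`, this is the Plücker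
    -- relation `[a,c][b,w] = [b,c][a,w] + [c,w][a,b]`.
    refine pos_of_mul_pos_right (a := _) ?_ ha.le
    refine lt_of_lt_of_le (add_pos_of_pos_of_nonneg (mul_pos hD hw) (mul_nonneg hb ih.le))
      (le_of_eq ?_)
    ring

theorem linearRadii_dual_pos {i : ℕ} (h0 : 0 < i) (h1 : i < n) :
    0 < P.linearRadii (P.dual 0) i := by
  obtain ⟨i, rfl⟩ : ∃ k, i = k + 1 := ⟨i - 1, by omega⟩
  have h := mul_pos (mul_pos (P.β_pos 0) (P.β_pos ((i + 1 : ℕ) : ℤ))) (P.det₂_edge_zero_pos i h1)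
  rw [linearRadii, dual_eq, dual_eq]
  push_cast at h ⊢
  simp only [det₂_apply, Pi.smul_apply, smul_eq_mul] at h ⊢
  linarith

theorem linearRadii_self (i : ℤ) : P.linearRadii (P.dual i) i = 0 := by
  simp only [linearRadii, det₂_apply]
  ring

theorem cuspsBelow_linearRadii_half : cuspsBelow (P.linearRadii (P.dual 0)) n = 1 := by
  have hn := P.two_le
  set r := P.linearRadii (P.dual 0) with hr
  have h0 : r 0 = 0 := P.linearRadii_self 0
  have hzero : ∀ b, b + 1 ≤ n → cuspsBelow r b = 0 := by
    intro b
    induction b with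
    | zero => classical exact fun _ => Nat.count_zero _
    | succ b ih =>
      intro hb
      rw [cuspsBelow_succ_of_not_cusp, ih (by omega)]
      intro hc
      have hb0 : 0 < b := Nat.pos_of_ne_zero fun h => by
        subst h
        exact hc.ne_zero (by simpa using h0)
      have h1 := P.linearRadii_dual_pos hb0 (by omega)
      have h2 := P.linearRadii_dual_pos (Nat.succ_pos b) (by omega)
      have := (isCuspAfter_iff_of_zero (j := ((b.succ : ℕ) : ℤ)) (by push_cast; omega)
        (fun k hk1 hk2 => by push_cast at hk2; omega) h2.ne').1 hc
      exact (mul_pos h1 h2).not_gt this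
  obtain ⟨k, rfl⟩ : ∃ k, n = k + 1 := ⟨n - 1, by omega⟩
  rw [cuspsBelow_succ_of_cusp, hzero k le_rfl]
  -- Side `n` is degenerate because side `0` is, so the next non-degenerate side is `n + 1`, whose
  -- radius is minus that of side `1`.
  refine ⟨1 + ((k + 1 : ℕ) : ℤ), by push_cast; omega, fun j hj1 hj2 => ?_, ?_⟩
  · have : j = 0 + ((k + 1 : ℕ) : ℤ) := by push_cast at hj2 ⊢; omega
    rw [this, hr, linearRadii_add, ← hr, h0, neg_zero]
  · rw [hr, linearRadii_add]
    have h1 := P.linearRadii_dual_pos (i := k) (by omega) (by omega)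
    have h2 := P.linearRadii_dual_pos (i := 1) (by omega) (by omega)
    have := mul_pos h1 h2
    push_cast at this ⊢
    linarith

theorem cuspsBelow_linearRadii (m : ℕ) :
    cuspsBelow (P.linearRadii (P.dual 0)) (2 * (m * n)) = 2 * m := by
  have := cuspsBelow_mul (r := P.linearRadii (P.dual 0)) (N := n) (c := -1) (by norm_num)
    (fun i => by rw [linearRadii_add]; ring) (2 * m)
  rw [P.cuspsBelow_linearRadii_half, mul_one] at this
  rwa [← mul_assoc]

theorem T_linearRadii (m : ℕ) (v : Fin 2 → ℝ) :
    P.T m ⟨P.linearRadii v, P.linearRadii_mem_L v m⟩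
      = (1 : ℝ) • ⟨P.linearRadii v, P.linearRadii_mem_L v m⟩ := by
  rw [one_smul]
  exact Subtype.ext (P.doubleEvolute_linearRadii v)

variable {P} {m : ℕ} [NeZero m] {b : Module.Basis (Fin (2 * (m * n))) ℝ (P.L m)}
  {μ : Fin (2 * (m * n)) → ℝ}

/-- The radii for `v = Q₀` and `v = Q₁` are independent and have eigenvalue 1, and the count `2m`
confines this eigenvalue to indices `2m - 1` and `2m`. Were one of these missing, the eigenspace
would be a line, yet only the first of the two vectors vanishes at side `0`. -/
theorem eigenvalue_eq_one (hb : ∀ i, P.T m (b i) = μ i • b i) (hμ : Monotone μ)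
    {i : Fin (2 * (m * n))} (hi : ((i : ℕ) + 1) / 2 = m) : μ i = 1 := by
  have hn := P.two_le
  have hm := NeZero.pos m
  by_contra hne
  set u : P.L m := ⟨_, P.linearRadii_mem_L (P.dual 0) m⟩ with hu
  set v : P.L m := ⟨_, P.linearRadii_mem_L (P.dual 1) m⟩ with hv
  have hTu : P.T m u = (1 : ℝ) • u := P.T_linearRadii m _
  have hTv : P.T m v = (1 : ℝ) • v := P.T_linearRadii m _
  have hu0 : (u : ℤ → ℝ) 0 = 0 := P.linearRadii_self 0
  have hu1 : 0 < (u : ℤ → ℝ) 1 := by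
    have := P.linearRadii_dual_pos (i := 1) one_pos (by omega)
    exact_mod_cast this
  have hv0 : (v : ℤ → ℝ) 0 ≠ 0 := by
    have : (v : ℤ → ℝ) 0 = -(u : ℤ → ℝ) 1 := by
      simp only [hu, hv, linearRadii, det₂_apply]
      ring
    rw [this]
    exact neg_ne_zero.2 hu1.ne'
  have hune : u ≠ 0 := fun h => hu1.ne' (by rw [h]; rfl)
  have hidx : ∀ k, μ k = 1 → ((k : ℕ) + 1) / 2 = m := by
    intro k hk
    have h1 := cuspsBelow_eigenbasis hb hμ k
    rw [P.cuspsBelow_eq_of_eigenspace (b.ne_zero k) hune (hb k) (hk ▸ hTu)] at h1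
    have h2 := P.cuspsBelow_linearRadii m
    change cuspsBelow u _ = _ at h2
    omega
  obtain ⟨o, ho⟩ : ∃ o, b.repr u o ≠ 0 := by
    by_contra! h
    exact hune (b.repr.injective (by rw [map_zero]; exact Finsupp.ext h))
  have ho1 := eigenvalue_eq_of_repr_ne_zero b hb hTu ho
  have huniq : ∀ x : P.L m, P.T m x = (1 : ℝ) • x → x = b.repr x o • b o := by
    intro x hx
    conv_lhs => rw [← b.sum_repr x]
    refine Finset.sum_eq_single o (fun k _ hk => ?_) (by simp)
    by_cases hk0 : b.repr x k = 0
    · rw [hk0, zero_smul]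
    exfalso
    have hk1 := eigenvalue_eq_of_repr_ne_zero b hb hx hk0
    have h3 := hidx k hk1
    have h4 := hidx o ho1
    have h5 : k ≠ i := by rintro rfl; exact hne hk1
    have h6 : o ≠ i := by rintro rfl; exact hne ho1
    rw [Ne, Fin.ext_iff] at hk h5 h6
    omega
  have h1 : b.repr u o * (b o : ℤ → ℝ) 0 = 0 := by
    rw [← hu0]
    exact (congrFun (congrArg Subtype.val (huniq u hTu)) 0).symm
  have h2 : (v : ℤ → ℝ) 0 = b.repr v o * (b o : ℤ → ℝ) 0 :=
    congrFun (congrArg Subtype.val (huniq v hTv)) 0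
  rw [(mul_eq_zero.1 h1).resolve_left ho, mul_zero] at h2
  exact hv0 h2

theorem eigenvalue_zero (hb : ∀ i, P.T m (b i) = μ i • b i) (hμ : Monotone μ)
    {i : Fin (2 * (m * n))} (hi : (i : ℕ) = 0) : μ i = 0 := by
  set u : P.L m := ⟨1, P.one_mem_L m⟩
  have hune : u ≠ 0 := fun h => one_ne_zero (congrArg Subtype.val h)
  obtain ⟨o, ho⟩ : ∃ o, b.repr u o ≠ 0 := by
    by_contra! h
    exact hune (b.repr.injective (by rw [map_zero]; exact Finsupp.ext h))
  have ho1 := eigenvalue_eq_of_repr_ne_zero b hb (P.T_one m) ho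
  exact le_antisymm (ho1 ▸ hμ (Fin.le_def.2 (by omega)))
    (P.eigenvalue_nonneg (b.ne_zero i) (hb i))

end SymmetricBall

/-! ### Grouping the eigenvalues into levels -/

/-- Level `k` consists of indices `2k - 1` and `2k`. At `k = 0` truncated subtraction yields index
`0`, and at `k = M` only `2M - 1` is in range. -/
theorem prod_range_two_mul {R : Type*} [CommMonoid R] (g : ℕ → R) {M : ℕ} (hM : 1 ≤ M) :
    ∏ i ∈ Finset.range (2 * M), g i = ∏ k ∈ Finset.range (M + 1),
      if k = 0 ∨ k = M then g (2 * k - 1) else g (2 * k - 1) * g (2 * k) := by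
  obtain ⟨K, rfl⟩ : ∃ K, M = K + 1 := ⟨M - 1, by omega⟩
  have key : ∀ J ≤ K, ∏ i ∈ Finset.range (2 * J + 1), g i = ∏ k ∈ Finset.range (J + 1),
      if k = 0 ∨ k = K + 1 then g (2 * k - 1) else g (2 * k - 1) * g (2 * k) := by
    intro J
    induction J with
    | zero => simp
    | succ J ih =>
      intro hJ
      rw [Finset.prod_range_succ _ (J + 1), ← ih (by omega), if_neg (by omega),
        show 2 * (J + 1) + 1 = 2 * J + 1 + 1 + 1 by ring, Finset.prod_range_succ,
        Finset.prod_range_succ, mul_assoc]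
      rfl
  rw [Finset.prod_range_succ _ (K + 1), ← key K le_rfl, if_pos (Or.inr rfl),
    show 2 * (K + 1) = 2 * K + 1 + 1 by ring, Finset.prod_range_succ]
  rfl

theorem prod_filter_levelFactor (ν : ℕ → ℝ) {M : ℕ} (hM : 1 ≤ M) (p : ℕ → Prop)
    [DecidablePred p] :
    ∏ k ∈ Finset.range (M + 1) with p k,
      levelFactor (fun k => ν (2 * k - 1)) (fun k => if k = M then ν (2 * k - 1) else ν (2 * k)) M k
      = ∏ i ∈ Finset.range (2 * M) with p ((i + 1) / 2),
        (Polynomial.X - Polynomial.C (ν i)) := by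
  rw [Finset.prod_filter, Finset.prod_filter, prod_range_two_mul _ hM]
  refine Finset.prod_congr rfl fun k _ => ?_
  have e1 : 1 ≤ k → (2 * k - 1 + 1) / 2 = k := by omega
  have e2 : (2 * k + 1) / 2 = k := by omega
  unfold levelFactor
  rw [e2]
  rcases Nat.eq_zero_or_pos k with rfl | hk
  · simp
  · rw [e1 hk]
    by_cases hkM : k = M
    · simp [hkM]
    · simp only [hk.ne', hkM, or_self, if_false]
      split_ifs <;> simp

/-! ### Symmetric and antisymmetric cycloids -/

namespace SymmetricBall

variable {n : ℕ} (P : SymmetricBall n)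

/-- The translation of the indices by half a period. -/
def halfShift (m : ℕ) : Module.End ℝ (P.L m) :=
  (LinearMap.funLeft ℝ ℝ fun i : ℤ => i + m * n).restrict fun r hr i => by
    have := hr (i + m * n)
    rw [add_right_comm] at this
    exact this

theorem halfShift_apply {m : ℕ} (r : P.L m) (i : ℤ) :
    (P.halfShift m r : ℤ → ℝ) i = (r : ℤ → ℝ) (i + m * n) := rfl

theorem halfShift_halfShift {m : ℕ} (r : P.L m) : P.halfShift m (P.halfShift m r) = r := by
  apply Subtype.ext
  funext i
  rw [halfShift_apply, halfShift_apply, ← r.2 i]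
  ring_nf

theorem T_halfShift {m : ℕ} (r : P.L m) :
    P.T m (P.halfShift m r) = P.halfShift m (P.T m r) := by
  apply Subtype.ext
  funext i
  exact (P.doubleEvolute_shift m r i).symm

theorem neg_one_smul_coe {m : ℕ} (r : P.L m) : (-1 : ℝ) • r = -r := by module

theorem cuspsBelow_mod_four_of_symmetric {m : ℕ} [NeZero m] {r : P.L m}
    (h : P.halfShift m r = (1 : ℝ) • r) : cuspsBelow r (2 * (m * n)) % 4 = 0 := by
  have hr : ∀ i, (r : ℤ → ℝ) (i + ((m * n : ℕ) : ℤ)) = (r : ℤ → ℝ) i := fun i => by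
    push_cast
    rw [one_smul] at h
    exact congrFun (congrArg Subtype.val h) i
  have hN := P.period_pos m
  obtain ⟨k, hk⟩ := even_cuspsBelow_of_periodic (by omega) hr
  rw [cuspsBelow_mul one_ne_zero (by simpa using hr)]
  omega

theorem cuspsBelow_mod_four_of_antisymmetric {m : ℕ} [NeZero m] {r : P.L m} (h0 : r ≠ 0)
    (h : P.halfShift m r = (-1 : ℝ) • r) : cuspsBelow r (2 * (m * n)) % 4 = 2 := by
  have hr : ∀ i, (r : ℤ → ℝ) (i + ((m * n : ℕ) : ℤ)) = -(r : ℤ → ℝ) i := fun i => by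
    push_cast
    rw [neg_one_smul_coe] at h
    exact congrFun (congrArg Subtype.val h) i
  have hN := P.period_pos m
  obtain ⟨k, hk⟩ := odd_cuspsBelow_of_antiperiodic (by omega) hr fun h => h0 (Subtype.ext h)
  rw [cuspsBelow_mul (c := -1) (by norm_num) (by simpa using hr)]
  omega

section Eigenbasis

variable {P} {m : ℕ} [NeZero m] {b : Module.Basis (Fin (2 * (m * n))) ℝ (P.L m)}
  {μ : Fin (2 * (m * n)) → ℝ}

/-- The half shift commutes with `T`. If `b i` had a nonzero component of the wrong symmetry, that
component would be an eigenvector for `μ i` whose count modulo 4 contradicts the count `2 * ((i + 1)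
/ 2)`. -/
theorem halfShift_eigenbasis (hb : ∀ i, P.T m (b i) = μ i • b i) (hμ : Monotone μ)
    (i : Fin (2 * (m * n))) :
    P.halfShift m (b i) = (-1 : ℝ) ^ (((i : ℕ) + 1) / 2) • b i := by
  have hT : P.T m (P.halfShift m (b i)) = μ i • P.halfShift m (b i) := by
    rw [T_halfShift, hb, map_smul]
  have hZ := cuspsBelow_eigenbasis hb hμ i
  rcases Nat.even_or_odd (((i : ℕ) + 1) / 2) with h | h
  · rw [h.neg_one_pow, one_smul]
    by_contra hne
    have h0 : P.halfShift m (b i) - b i ≠ 0 := sub_ne_zero.2 hne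
    have h1 := P.cuspsBelow_mod_four_of_antisymmetric h0 (by
      rw [map_sub, halfShift_halfShift]; module)
    rw [P.cuspsBelow_eq_of_eigenspace h0 (b.ne_zero i) (μ := μ i) (by
      rw [map_sub, hT, hb, smul_sub]) (hb i), hZ] at h1
    obtain ⟨k, hk⟩ := h
    omega
  · rw [h.neg_one_pow]
    by_contra hne
    have h0 : P.halfShift m (b i) + b i ≠ 0 := fun h' => hne (by
      rw [neg_one_smul_coe]; exact eq_neg_of_add_eq_zero_left h')
    have h1 := P.cuspsBelow_mod_four_of_symmetric (r := P.halfShift m (b i) + b i) (by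
      rw [map_add, halfShift_halfShift]; module)
    rw [P.cuspsBelow_eq_of_eigenspace h0 (b.ne_zero i) (μ := μ i) (by
      rw [map_add, hT, hb, smul_add]) (hb i), hZ] at h1
    obtain ⟨k, hk⟩ := h
    omega

omit [NeZero m] in
theorem charpoly_restrict {U : Submodule ℝ (ℤ → ℝ)} [FiniteDimensional ℝ U]
    (hb : ∀ i, P.T m (b i) = μ i • b i) (hU : U ≤ P.L m)
    (hT : ∀ r ∈ U, P.doubleEvolute r ∈ U) (p : Fin (2 * (m * n)) → Prop) [DecidablePred p]
    (hp : ∀ i, p i → (b i : ℤ → ℝ) ∈ U)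
    (hspan : ∀ u : P.L m, (u : ℤ → ℝ) ∈ U → ∀ i, b.repr u i ≠ 0 → p i) :
    LinearMap.charpoly (P.doubleEvolute.restrict hT)
      = ∏ i with p i, (Polynomial.X - Polynomial.C (μ i)) := by
  let v : {i // p i} → U := fun i => ⟨b i, hp i i.2⟩
  have hli : LinearIndependent ℝ v := by
    refine LinearIndependent.of_comp (Submodule.inclusion hU) ?_
    exact b.linearIndependent.comp Subtype.val Subtype.val_injective
  have hsp : ⊤ ≤ Submodule.span ℝ (Set.range v) := by
    intro u _
    set u' : P.L m := Submodule.inclusion hU u with hu'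
    have h1 : u = ∑ i : {i // p i}, b.repr u' i • v i := by
      apply Submodule.inclusion_injective hU
      rw [map_sum, ← hu']
      conv_lhs => rw [← b.sum_repr u']
      have h2 : ∑ i, b.repr u' i • b i = ∑ i with p i, b.repr u' i • b i := by
        rw [Finset.sum_filter]
        refine Finset.sum_congr rfl fun i _ => ?_
        split_ifs with h
        · rfl
        · rw [not_not.1 (mt (hspan u' u.2 i) h), zero_smul]
      rw [h2, Finset.sum_subtype (p := p) _ (by simp)]
      rfl
    rw [h1]
    exact Submodule.sum_mem _ fun i _ =>
      Submodule.smul_mem _ _ (Submodule.subset_span ⟨i, rfl⟩)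
  have hv : ∀ i, P.doubleEvolute.restrict hT (Module.Basis.mk hli hsp i)
      = μ i • Module.Basis.mk hli hsp i := by
    intro i
    rw [Module.Basis.mk_apply]
    have := congrArg Subtype.val (hb i.1)
    exact Subtype.ext this
  rw [charpoly_eq_prod_of_eigenbasis (μ := fun i : {i // p i} => μ i) _ hv]
  exact (Finset.prod_subtype (p := p) (Finset.univ.filter p) (by simp)
    fun i => Polynomial.X - Polynomial.C (μ i)).symm

omit [NeZero m] in
theorem mem_S_iff {r : P.L m} : (r : ℤ → ℝ) ∈ P.S m ↔ P.halfShift m r = (1 : ℝ) • r := by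
  rw [one_smul]
  exact ⟨fun h => Subtype.ext (funext h), fun h i => congrFun (congrArg Subtype.val h) i⟩

omit [NeZero m] in
theorem mem_A_iff {r : P.L m} : (r : ℤ → ℝ) ∈ P.A m ↔ P.halfShift m r = (-1 : ℝ) • r := by
  rw [neg_one_smul_coe]
  exact ⟨fun h => Subtype.ext (funext h), fun h i => congrFun (congrArg Subtype.val h) i⟩

theorem charpoly_TS (hb : ∀ i, P.T m (b i) = μ i • b i) (hμ : Monotone μ) :
    (P.TS m).charpoly = ∏ i ∈ Finset.univ.filter fun i : Fin (2 * (m * n)) => Even (((i : ℕ) + 1) / 2),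
      (Polynomial.X - Polynomial.C (μ i)) := by
  refine charpoly_restrict hb (P.S_le_L m) _ _ (fun i hi => ?_) (fun u hu i hi => ?_)
  · rw [mem_S_iff, halfShift_eigenbasis hb hμ, hi.neg_one_pow]
  -- The half shift is diagonal in the same basis, so an element of `S_{mP}` has nonzero coordinates
  -- only where its sign is `1`.
  · have := eigenvalue_eq_of_repr_ne_zero b (halfShift_eigenbasis hb hμ) (mem_S_iff.1 hu) hi
    by_contra h
    rw [(Nat.not_even_iff_odd.1 h).neg_one_pow] at this
    norm_num at this

theorem charpoly_TA (hb : ∀ i, P.T m (b i) = μ i • b i) (hμ : Monotone μ) :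
    (P.TA m).charpoly = ∏ i ∈ Finset.univ.filter fun i : Fin (2 * (m * n)) => Odd (((i : ℕ) + 1) / 2),
      (Polynomial.X - Polynomial.C (μ i)) := by
  refine charpoly_restrict hb (P.A_le_L m) _ _ (fun i hi => ?_) (fun u hu i hi => ?_)
  · rw [mem_A_iff, halfShift_eigenbasis hb hμ, hi.neg_one_pow]
  · have := eigenvalue_eq_of_repr_ne_zero b (halfShift_eigenbasis hb hμ) (mem_A_iff.1 hu) hi
    by_contra h
    rw [(Nat.not_odd_iff_even.1 h).neg_one_pow] at this
    norm_num at this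

end Eigenbasis

end SymmetricBall

/-! ### Assembly -/

theorem prod_univ_filter_eq_range {R : Type*} [CommMonoid R] {N : ℕ} (f : ℕ → R) (p : ℕ → Prop)
    [DecidablePred p] :
    ∏ i ∈ Finset.univ.filter (fun i : Fin N => p i), f i = ∏ i ∈ Finset.range N with p i, f i := by
  rw [Finset.prod_filter, Finset.prod_filter, Finset.prod_range]

theorem mainTheorem6 {n : ℕ} (P : SymmetricBall n) (m : ℕ) [NeZero m] :
    ∃ σ₁ σ₂ : ℕ → ℝ,
      -- the unpaired eigenvalues `σ₀` and `σ_{mn}`, written twice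
      σ₂ 0 = σ₁ 0 ∧ σ₂ (m * n) = σ₁ (m * n) ∧
      -- the ordering
      σ₁ 0 = 0 ∧
      (∀ k, 1 ≤ k → k < m * n → σ₁ k ≤ σ₂ k) ∧
      (∀ k, k < m * n → σ₂ k < σ₁ (k + 1)) ∧
      σ₁ m = 1 ∧ σ₂ m = 1 ∧
      -- these are the eigenvalues with multiplicity, and the cycloids span `L_{mP}`
      (P.T m).charpoly = ∏ k ∈ Finset.range (m * n + 1), levelFactor σ₁ σ₂ (m * n) k ∧
      (⨆ μ : ℝ, (P.T m).eigenspace μ) = ⊤ ∧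
      -- the odd indices belong to `A_{mP}` and the even ones to `S_{mP}`
      (P.TA m).charpoly =
        ∏ k ∈ Finset.range (m * n + 1) with Odd k, levelFactor σ₁ σ₂ (m * n) k ∧
      (P.TS m).charpoly =
        ∏ k ∈ Finset.range (m * n + 1) with Even k, levelFactor σ₁ σ₂ (m * n) k ∧
      -- every cycloid of index `k` has exactly `2k` cusps
      (∀ k ≤ m * n, ∀ r : P.L m,
        (P.T m).HasEigenvector (σ₁ k) r ∨ (P.T m).HasEigenvector (σ₂ k) r →
          cuspCount (2 * (m * n)) r = 2 * k) := by
  have hn := P.two_le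
  have hm := NeZero.pos m
  have hN := P.period_pos m
  have hmn : m < m * n := by nlinarith
  obtain ⟨b, μ, hμ, hb⟩ := P.exists_eigenbasis m
  let ν : ℕ → ℝ := fun i => if h : i < 2 * (m * n) then μ ⟨i, h⟩ else 0
  have hν : ∀ i (h : i < 2 * (m * n)), ν i = μ ⟨i, h⟩ := fun i h => dif_pos h
  have hν' : ∀ i : Fin (2 * (m * n)), μ i = ν i := fun i => (hν i i.2).symm
  have hνmono : ∀ i j, i ≤ j → j < 2 * (m * n) → ν i ≤ ν j := fun i j hij hj => by
    rw [hν i (by omega), hν j hj]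
    exact hμ (Fin.mk_le_mk.2 hij)
  have hcusp : ∀ i < 2 * (m * n), ∀ r : P.L m, (P.T m).HasEigenvector (ν i) r →
      cuspsBelow r (2 * (m * n)) = 2 * ((i + 1) / 2) := by
    intro i hi r hr
    rw [← SymmetricBall.cuspsBelow_eigenbasis hb hμ ⟨i, hi⟩]
    refine P.cuspsBelow_eq_of_eigenspace (μ := ν i) hr.2 (b.ne_zero _) hr.apply_eq_smul ?_
    rw [hν i hi]
    exact hb _
  have hvec : ∀ i (h : i < 2 * (m * n)), (P.T m).HasEigenvector (ν i) (b ⟨i, h⟩) := fun i h =>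
    ⟨Module.End.mem_eigenspace_iff.2 (by rw [hν i h]; exact hb _), b.ne_zero _⟩
  have hone : ∀ i < 2 * (m * n), (i + 1) / 2 = m → ν i = 1 := fun i hi h => by
    rw [hν i hi]
    exact SymmetricBall.eigenvalue_eq_one hb hμ h
  -- Level `k` reads positions `2k - 1` and `2k`. Position `2mn` does not exist, so the top level
  -- repeats `2mn - 1`; at `k = 0` both positions are `0`.
  refine ⟨fun k => ν (2 * k - 1), fun k => if k = (m * n) then ν (2 * k - 1) else ν (2 * k),
    ?_, ?_, ?_, ?_, ?_, ?_, ?_, ?_, ?_, ?_, ?_, ?_⟩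
  · simp
  · simp
  · change ν 0 = 0
    rw [hν 0 hN]
    exact SymmetricBall.eigenvalue_zero hb hμ rfl
  · intro k h1 h2
    simp only [if_neg h2.ne]
    exact hνmono _ _ (by omega) (by omega)
  · intro k hk
    simp only [if_neg hk.ne]
    change ν (2 * k) < ν (2 * k + 1)
    -- Equality across two levels would give the same vector both `2k` and `2k + 2` cusps.
    refine lt_of_le_of_ne (hνmono _ _ (by omega) (by omega)) fun h => ?_
    have h1 := hcusp (2 * k) (by omega) _ (hvec _ (by omega))
    have h2 := hcusp (2 * k + 1) (by omega) _ (h ▸ hvec (2 * k) (by omega))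
    omega
  · exact hone _ (by omega) (by omega)
  · simp only [if_neg hmn.ne]
    exact hone _ (by omega) (by omega)
  · have h1 := prod_filter_levelFactor ν (M := m * n) (by omega) fun _ => True
    rw [Finset.filter_true, Finset.filter_true] at h1
    rw [h1, charpoly_eq_prod_of_eigenbasis b hb, Finset.prod_range]
    simp only [hν']
  · exact iSup_eigenspace_eq_top_of_eigenbasis b hb
  · rw [prod_filter_levelFactor ν (by omega), SymmetricBall.charpoly_TA hb hμ,
      ← prod_univ_filter_eq_range]
    simp only [hν']
  · rw [prod_filter_levelFactor ν (by omega), SymmetricBall.charpoly_TS hb hμ,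
      ← prod_univ_filter_eq_range]
    simp only [hν']
  · intro k hk r hr
    rw [cuspCount_eq_cuspsBelow]
    rcases hr with hr | hr
    · rw [hcusp _ (by omega) r hr]
      omega
    · by_cases hkM : k = (m * n)
      · simp only [if_pos hkM] at hr
        rw [hcusp _ (by omega) r hr]
        omega
      · simp only [if_neg hkM] at hr
        rw [hcusp _ (by omega) r hr]
        omega
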